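/- **Setting.** There are $n$ workers. Worker $i$ has a computation power $\upsilon_i:\mathbb R_{\ge 0}\to\mathbb R_{\ge 0}$ that is continuous almost everywhere and integrable on bounded intervals; put $V_i(t)=\int_0^t\upsilon_i(\tau)\,d\tau$. Let $f:\mathbb R^d\to\mathbb R$ be differentiable. A *$p$-BCM oracle* for $f$ consists of a distribution $\mathcal D$ and a map $\widehat\nabla F(x;\xi)$ with $\mathbb E_{\xi\sim\mathcal D}[\widehat\nabla F(x;\xi)]=\nabla f(x)$ and $\mathbb E_{\xi\sim\mathcal D}\|\widehat\nabla F(x;\xi)-\nabla f(x)\|^p\le\sigma^p$ for all $x\in\mathbb R^d$. Worker $i$ has a state $s_i=(s_{t,i},s_{x,i},s_{q,i})\in\mathbb R_{\ge0}\times\mathbb R^d\times\{0,1\}$, initially $(0,0,0)$. When it is called at time $t$ with a point $x$, its new state and its output $g$ are $$(s_i^+,g)=O_{V_i}(t,x,s_i,\xi)=\begin{cases}((t,x,1),0), & s_{q,i}=0,\\ ((s_{t,i},s_{x,i},1),0), & s_{q,i}=1,\ V_i(t)-V_i(s_{t,i})<1,\\ ((0,0,0),\widehat\nabla F(s_{x,i};\xi)),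 & s_{q,i}=1,\ V_i(t)-V_i(s_{t,i})\ge 1.\end{cases}$$ An *asynchronous stochastic first-order oracle algorithm* is a sequence of maps $A_k$, $k\ge 0$, with $(t_{k+1},i_{k+1},x_k)=A_k(g_1,\dots,g_k)$, where $t_0=0$, $t_{k+1}\ge t_k$, $i_{k+1}\in[n]$ and $\mathrm{supp}(x_k)\subseteq\bigcup_{s=1}^k\mathrm{supp}(g_s)$ (so $x_0=0$). In round $k$ it calls worker $i_{k+1}$ at time $t_{k+1}$ with the point $x_k$ and receives $g_{k+1}$; the samples $\xi$ of different rounds are independent with law $\mathcal D$. Let $S_t=\{k\ge0: t_k\le t\}$ be the set of indices of the iterates available at time $t$. **Theorem.** There is an absolute constant $c>0$ such that the following holds. For all $L,\Delta,\sigma>0$, $p\in(1,2]$, $n$, computation powers $\upsilon_1,\dots,\upsilon_n$ as above, and $0<\epsilon\le c\sqrt{L\Delta}$, there exist a dimension $d$, an $L$-smooth function $f:\mathbb R^d\to\mathbb R$, bounded below, with $f(0)-\inf_x f(x)\le\Delta$, and a $p$-BCM oracle for $f$ with noise level $\sigma$, such that for every asynchronous stochastic first-order oracle algorithm and every $t\ge0$: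 $$\mathbb E\Bigl[\inf_{k\in S_t}\|\nabla f(x_k)\|\Bigr]\le\epsilon\quad\Longrightarrow\quad t>T_{\tilde K}.$$ In particular, if a random output $\hat x\in\{x_k:k\in S_t\}$ satisfies $\mathbb E\|\nabla f(\hat x)\|\le\epsilon$, then $t>T_{\tilde K}$. Here $$\tilde K=\left\lfloor\frac12\left\lfloor\frac{L\Delta}{29184\,\epsilon^2}\right\rfloor+\log\frac12\right\rfloor,\qquad q=\min\left\{\left(\frac{92\cdot2^{1/p}\epsilon}{\sigma}\right)^{\frac p{p-1}},1\right\},$$ $T_0=0$, and for $K\ge1$ $$T_K=\min\left\{T\ge0:\ \sum_{i=1}^n\int_{T_{K-1}}^T\upsilon_i(\tau)\,d\tau\ge\left\lceil\frac1{4q}\right\rceil\right\},$$ with $\min\emptyset=+\infty$, and $T_K=+\infty$ if $T_{K-1}=+\infty$. Moreover $\tilde K=\Omega(L\Delta/\epsilon^2)$, that is, $\tilde K\ge C\,L\Delta/\epsilon^2$ with an absolute constant $C>0$ for all $L,\Delta>0$ and $0<\epsilon\le c\sqrt{L\Delta}$; and $\lceil 1/(4q)\rceil=\Theta\bigl(\lceil\sigma/\epsilon\rceil^{p/(p-1)}\bigr)$,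 with constants that depend only on $p$, for all $\sigma,\epsilon>0$. -/

import Mathlib

open MeasureTheory ProbabilityTheory
open scoped NNReal ENNReal Gradient

noncomputable section

/-- `ℝᵈ` with the Euclidean norm. -/
abbrev Euc (d : ℕ) : Type := EuclideanSpace ℝ (Fin d)

/-- `υ` is (on `[0, ∞)`) an admissible computation power: nonnegative, continuous almost
everywhere, and with a finite integral over every `[0, t]`. -/
structure IsComputationPower (υ : ℝ → ℝ) : Prop where
  nonneg : ∀ t, 0 ≤ t → 0 ≤ υ t
  ae_continuous : ∀ᵐ t ∂(volume.restrict (Set.Ici (0 : ℝ))),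
    ContinuousWithinAt υ (Set.Ici 0) t
  integrable : ∀ t, 0 ≤ t → IntervalIntegrable υ volume 0 t

/-- The cumulative computation work `V(t) = ∫₀ᵗ υ(τ) dτ`. -/
def work (υ : ℝ → ℝ) (t : ℝ≥0) : ℝ := ∫ τ in (0 : ℝ)..t, υ τ

/-- `f` is differentiable with `L`-Lipschitz gradient. -/
def IsLSmooth {d : ℕ} (L : ℝ) (f : Euc d → ℝ) : Prop :=
  Differentiable ℝ f ∧ ∀ x y, ‖∇ f x - ∇ f y‖ ≤ L * ‖x - y‖

/-- `G x ξ`, `ξ ∼ D`, is an unbiased estimate of `∇ f x` whose `p`-th central moment is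
at most `σ ^ p`. -/
structure IsPBCMOracle {d : ℕ} {Ξ : Type*} [MeasurableSpace Ξ] (f : Euc d → ℝ)
    (D : Measure Ξ) (G : Euc d → Ξ → Euc d) (p σ : ℝ) : Prop where
  integrable : ∀ x, Integrable (G x) D
  unbiased : ∀ x, ∫ ξ, G x ξ ∂D = ∇ f x
  moment_le : ∀ x, ∫⁻ ξ, ‖G x ξ - ∇ f x‖ₑ ^ p ∂D ≤ ENNReal.ofReal (σ ^ p)

/-- The internal state `(s_t, s_x, s_q)` of a worker; `busy` is `s_q = 1`. -/
structure WorkerState (d : ℕ) where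
  startTime : ℝ≥0
  point : Euc d
  busy : Bool

/-- The state `(0, 0, 0)`. -/
def WorkerState.idle (d : ℕ) : WorkerState d := ⟨0, 0, false⟩

open Classical in
/-- The time-sensitive stochastic first-order oracle of a worker with cumulative work `V`:
an idle worker starts computing at the requested point; a busy worker returns its stochastic
gradient once a unit of work has been done since it started, and `0` before that. -/
def universalOracle {d : ℕ} {Ξ : Type*} (V : ℝ≥0 → ℝ) (G : Euc d → Ξ → Euc d)
    (t : ℝ≥0) (x : Euc d) (s : WorkerState d) (ξ : Ξ) : WorkerState d × Euc d :=
  if s.busy = false then (⟨t, x, true⟩, 0)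
  else if V t - V s.startTime < 1 then (⟨s.startTime, s.point, true⟩, 0)
  else (WorkerState.idle d, G s.point ξ)

/-- The output `(t_{k+1}, i_{k+1}, x_k)` of round `k` of an algorithm. -/
structure Query (n d : ℕ) where
  time : ℝ≥0
  worker : Fin n
  point : Euc d

/-- An asynchronous stochastic first-order oracle algorithm over `n` workers on `ℝᵈ`:
a sequence of maps `A_k (g_1, …, g_k) = (t_{k+1}, i_{k+1}, x_k)` with nondecreasing times and
`supp x_k ⊆ ⋃_{s ≤ k} supp g_s` (so that `x_0 = 0`). -/
structure AsyncAlgorithm (n d : ℕ) where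
  query : (k : ℕ) → (Fin k → Euc d) → Query n d
  time_mono : ∀ (k : ℕ) (g : Fin (k + 1) → Euc d),
    (query k fun s => g s.castSucc).time ≤ (query (k + 1) g).time
  supp_subset : ∀ (k : ℕ) (g : Fin k → Euc d) (j : Fin d),
    (query k g).point j ≠ 0 → ∃ s : Fin k, g s j ≠ 0

namespace AsyncAlgorithm

variable {n d : ℕ} {Ξ : Type*}

/-- The observed oracle outputs `(g_1, …, g_k)` and the states of the workers after `k` rounds.
The oracle call of round `k` uses the sample `ξ k`. -/
def run (A : AsyncAlgorithm n d) (υ : Fin n → ℝ → ℝ) (G : Euc d → Ξ → Euc d) (ξ : ℕ → Ξ) :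
    (k : ℕ) → (Fin k → Euc d) × (Fin n → WorkerState d)
  | 0 => (fun s => s.elim0, fun _ => WorkerState.idle d)
  | k + 1 =>
    let h := A.run υ G ξ k
    let a := A.query k h.1
    let r := universalOracle (work (υ a.worker)) G a.time a.point (h.2 a.worker) (ξ k)
    (Fin.snoc (α := fun _ => Euc d) h.1 r.2, Function.update h.2 a.worker r.1)

/-- The iterate `x_k`. -/
def iterate (A : AsyncAlgorithm n d) (υ : Fin n → ℝ → ℝ) (G : Euc d → Ξ → Euc d) (ξ : ℕ → Ξ)
    (k : ℕ) : Euc d :=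
  (A.query k (A.run υ G ξ k).1).point

/-- The wall-clock times `t_k`, with `t_0 = 0`. -/
def clock (A : AsyncAlgorithm n d) (υ : Fin n → ℝ → ℝ) (G : Euc d → Ξ → Euc d) (ξ : ℕ → Ξ) :
    ℕ → ℝ≥0
  | 0 => 0
  | k + 1 => (A.query k (A.run υ G ξ k).1).time

/-- The set `S_t = {k : t_k ≤ t}` of indices of the iterates available at time `t`. -/
def available (A : AsyncAlgorithm n d) (υ : Fin n → ℝ → ℝ) (G : Euc d → Ξ → Euc d) (ξ : ℕ → Ξ)
    (t : ℝ≥0) : Set ℕ :=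
  {k | A.clock υ G ξ k ≤ t}

end AsyncAlgorithm

/-- `q = min {(92 · 2^{1/p} ε / σ)^{p/(p-1)}, 1}`. -/
def gateProb (p σ ε : ℝ) : ℝ :=
  min ((92 * (2 : ℝ) ^ (1 / p) * ε / σ) ^ (p / (p - 1))) 1

/-- `⌈1 / (4 q)⌉`. -/
def batchSize (p σ ε : ℝ) : ℕ := ⌈1 / (4 * gateProb p σ ε)⌉₊

/-- `K̃ = ⌊(1/2) ⌊L Δ / (29184 ε²)⌋ + log (1/2)⌋`. -/
def numEpochs (L Δ ε : ℝ) : ℤ :=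
  ⌊(1 / 2 : ℝ) * (⌊L * Δ / (29184 * ε ^ 2)⌋ : ℝ) + Real.log (1 / 2)⌋

/-- `T_0 = 0`, `T_K = min {T ≥ 0 : ∑ᵢ ∫_{T_{K-1}}^T υᵢ(τ) dτ ≥ N}` with `min ∅ = ∞`
(and `T_K = ∞` if `T_{K-1} = ∞`). For admissible powers the integrals are continuous in `T`,
so that the infimum of a nonempty such set is attained. -/
def epochTime {n : ℕ} (υ : Fin n → ℝ → ℝ) (N : ℕ) : ℕ → ℝ≥0∞
  | 0 => 0
  | K + 1 => sInf {S : ℝ≥0∞ | epochTime υ N K ≠ ∞ ∧ ∃ T : ℝ≥0, S = T ∧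
      (N : ℝ) ≤ ∑ i, ∫ τ in (epochTime υ N K).toReal..(T : ℝ), υ i τ}

end

/-! The hard instance combines a nonconvex chain with an oracle that seldom lets the algorithm move
along it. In the chain, a coordinate has a nonzero partial derivative at a point vanishing from that
coordinate on only if it is the first of the zero tail, and the gradient has norm at least `4 * ε`
as long as the last coordinate is zero (`exists_smooth_chain`). The oracle flips a coin of bias `q`:
on tails it hides the partial derivatives in the zero tail of the point, on heads it multiplies them
by `1 / q`. It is unbiased, and since at most one hidden entry is nonzero, its `p`-th moment does
not depend on the dimension (`isPBCMOracle_gatedGradient`).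

Each head reveals at most one new coordinate, and each returned gradient costs its worker one unit
of work (`run_invariant`). Hence a total work of `m` up to time `t` buys at most `m` coin flips
(`trialCount_completes_le`), however adaptively they are scheduled. Whether a round flips a coin is
decided by the earlier flips, so an exponential supermartingale bounds the probability of `d` heads
among them (`measure_exists_le_successCount_le`). By `sum_work_le_of_le_epochTime`, `t ≤ T_K̃`
forces `m ≤ K̃ * N`, with `N` the batch size, and then this probability is at most `1/2`. With
probability at least `1/2` the last coordinate of every available iterate is therefore zero, and the
expected gradient norm is at least `2 * ε` (`lt_lintegral_iInf_norm_gradient`). -/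

noncomputable section

/-! ### Piecewise quadratic step functions -/

/-- The convex ramp `max(x, 0)² / 2`. -/
def halfSq (x : ℝ) : ℝ := max x 0 ^ 2 / 2

theorem hasDerivAt_halfSq (x : ℝ) : HasDerivAt halfSq (max x 0) x := by
  have hne : ∀ y : ℝ, y ≠ 0 → HasDerivAt halfSq (max y 0) y := by
    intro y hy
    rcases lt_or_gt_of_ne hy with h | h
    · rw [max_eq_right h.le]
      refine (hasDerivAt_const y (0 : ℝ)).congr_of_eventuallyEq ?_
      filter_upwards [Iio_mem_nhds h] with z hz
      simp [halfSq, max_eq_right (le_of_lt (Set.mem_Iio.1 hz))]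
    · rw [max_eq_left h.le]
      have h2 : HasDerivAt (fun z : ℝ => z ^ 2 / 2) y y := by
        simpa using (hasDerivAt_pow 2 y).div_const 2
      refine h2.congr_of_eventuallyEq ?_
      filter_upwards [Ioi_mem_nhds h] with z hz
      simp [halfSq, max_eq_left (le_of_lt (Set.mem_Ioi.1 hz))]
  rcases eq_or_ne x 0 with rfl | h
  · refine hasDerivAt_of_hasDerivAt_of_ne (g := fun y => max y 0) hne ?_ ?_
    · unfold halfSq; fun_prop
    · fun_prop
  · exact hne x h

/-- The derivative of `smoothStep`: a tent of height `1` supported on `[0, 2]`. -/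
def tent (x : ℝ) : ℝ := max x 0 - 2 * max (x - 1) 0 + max (x - 2) 0

/-- A `C¹` step that is `0` on `(-∞, 0]` and `1` on `[2, ∞)`. -/
def smoothStep (x : ℝ) : ℝ := halfSq x - 2 * halfSq (x - 1) + halfSq (x - 2)

theorem hasDerivAt_smoothStep (x : ℝ) : HasDerivAt smoothStep (tent x) x := by
  have h1 := (hasDerivAt_halfSq (x - 1)).comp_sub_const x 1
  have h2 := (hasDerivAt_halfSq (x - 2)).comp_sub_const x 2
  exact ((hasDerivAt_halfSq x).sub (h1.const_mul 2)).add h2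

theorem tent_eq (x : ℝ) : tent x = max (1 - |x - 1|) 0 := by
  unfold tent
  rcases max_cases x 0 with h1 | h1 <;> rcases max_cases (x - 1) 0 with h2 | h2 <;>
    rcases max_cases (x - 2) 0 with h3 | h3 <;> rcases abs_cases (x - 1) with h4 | h4 <;>
    rcases max_cases (1 - |x - 1|) 0 with h5 | h5 <;> linarith

theorem tent_nonneg (x : ℝ) : 0 ≤ tent x := by rw [tent_eq]; exact le_max_right _ _

theorem tent_le_one (x : ℝ) : tent x ≤ 1 := by
  rw [tent_eq]; exact max_le (by linarith [abs_nonneg (x - 1)]) zero_le_one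

theorem le_tent (x : ℝ) : 1 - |x - 1| ≤ tent x := by rw [tent_eq]; exact le_max_left _ _

theorem tent_zero : tent 0 = 0 := by norm_num [tent]

theorem abs_tent_sub_le (x y : ℝ) : |tent x - tent y| ≤ |x - y| := by
  rw [tent_eq, tent_eq]
  refine (abs_max_sub_max_le_abs _ _ _).trans ?_
  have := abs_abs_sub_abs_le (y - 1) (x - 1)
  rw [show 1 - |x - 1| - (1 - |y - 1|) = |y - 1| - |x - 1| by ring]
  refine this.trans (le_of_eq ?_)
  rw [abs_sub_comm]; congr 1; ring

theorem smoothStep_zero : smoothStep 0 = 0 := by norm_num [smoothStep, halfSq]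

theorem smoothStep_of_two_le {x : ℝ} (h : 2 ≤ x) : smoothStep x = 1 := by
  unfold smoothStep halfSq
  rw [max_eq_left (by linarith), max_eq_left (by linarith), max_eq_left (by linarith)]
  ring

theorem smoothStep_nonneg (x : ℝ) : 0 ≤ smoothStep x := by
  unfold smoothStep halfSq
  rcases max_cases x 0 with ⟨h1, h1'⟩ | ⟨h1, h1'⟩ <;>
    rcases max_cases (x - 1) 0 with ⟨h2, h2'⟩ | ⟨h2, h2'⟩ <;>
    rcases max_cases (x - 2) 0 with ⟨h3, h3'⟩ | ⟨h3, h3'⟩ <;> rw [h1, h2, h3] <;> nlinarith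

theorem smoothStep_le_one (x : ℝ) : smoothStep x ≤ 1 := by
  unfold smoothStep halfSq
  rcases max_cases x 0 with ⟨h1, h1'⟩ | ⟨h1, h1'⟩ <;>
    rcases max_cases (x - 1) 0 with ⟨h2, h2'⟩ | ⟨h2, h2'⟩ <;>
    rcases max_cases (x - 2) 0 with ⟨h3, h3'⟩ | ⟨h3, h3'⟩ <;> rw [h1, h2, h3] <;> nlinarith

theorem abs_smoothStep_sub_le (x y : ℝ) : |smoothStep x - smoothStep y| ≤ |x - y| := by
  have := Convex.norm_image_sub_le_of_norm_hasDerivWithin_le (f := smoothStep) (f' := tent)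
    (s := Set.univ) (C := 1) (x := y) (y := x)
    (fun z _ => (hasDerivAt_smoothStep z).hasDerivWithinAt)
    (fun z _ => by rw [Real.norm_eq_abs, abs_of_nonneg (tent_nonneg z)]; exact tent_le_one z)
    convex_univ trivial trivial
  simpa using this

/-! ### The chain function, its gradient and its rescaling -/

/-- The `k`-th coordinate as a continuous linear functional, `0` beyond the dimension. -/
def coordL (d k : ℕ) : Euc d →L[ℝ] ℝ :=
  if h : k < d then EuclideanSpace.proj (⟨k, h⟩ : Fin d) else 0

theorem coordL_fin {d : ℕ} (i : Fin d) (x : Euc d) : coordL d i x = x i := by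
  simp [coordL]

theorem coordL_self (d : ℕ) : coordL d d = 0 := by simp [coordL]

theorem sum_coordL_sq {d : ℕ} (x : Euc d) : ∑ k ∈ Finset.range d, coordL d k x ^ 2 = ‖x‖ ^ 2 := by
  rw [EuclideanSpace.norm_sq_eq, Finset.sum_range]
  simp [coordL_fin]

/-- The coordinate preceding the `k`-th one, with the value `2` before the first. -/
def prevCoord {d : ℕ} (x : Euc d) : ℕ → ℝ
  | 0 => 2
  | k + 1 => coordL d k x

/-- A nonconvex chain: decreasing in the `k`-th coordinate as long as this is below `2` and the
preceding one is at least `2`. -/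
def chain (d : ℕ) (x : Euc d) : ℝ :=
  -smoothStep (coordL d 0 x / 3 + 1)
    + (-(∑ k ∈ Finset.range d, smoothStep (coordL d k x) * smoothStep (coordL d (k + 1) x / 3 + 1))
    + ∑ k ∈ Finset.range d, halfSq (-coordL d k x))

/-- The partial derivatives of `chain`. -/
def chainPartial {d : ℕ} (x : Euc d) (k : ℕ) : ℝ :=
  -(smoothStep (prevCoord x k) * (tent (coordL d k x / 3 + 1) / 3))
    - tent (coordL d k x) * smoothStep (coordL d (k + 1) x / 3 + 1)
    - max (-coordL d k x) 0

/-- The gradient of `chain`. -/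
def chainGrad {d : ℕ} (x : Euc d) : Euc d := WithLp.toLp 2 fun i : Fin d => chainPartial x i

theorem hasGradientAt_chain {d : ℕ} (x : Euc d) : HasGradientAt (chain d) (chainGrad x) x := by
  have hc : ∀ k, HasFDerivAt (fun y : Euc d => coordL d k y) (coordL d k) x :=
    fun k => (coordL d k).hasFDerivAt
  have hΨ : ∀ k, HasFDerivAt (fun y : Euc d => smoothStep (coordL d k y))
      (tent (coordL d k x) • coordL d k) x :=
    fun k => (hasDerivAt_smoothStep _).comp_hasFDerivAt x (hc k)
  have hΦ : ∀ k, HasFDerivAt (fun y : Euc d => smoothStep (coordL d k y / 3 + 1))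
      ((tent (coordL d k x / 3 + 1) / 3) • coordL d k) x := by
    intro k
    have h1 : HasDerivAt (fun z : ℝ => smoothStep (z / 3 + 1))
        (tent (coordL d k x / 3 + 1) / 3) (coordL d k x) := by
      have h2 : HasDerivAt (fun z : ℝ => z / 3 + 1) (1 / 3) (coordL d k x) :=
        ((hasDerivAt_id _).div_const 3).add_const 1
      have h3 := (hasDerivAt_smoothStep (coordL d k x / 3 + 1)).comp (coordL d k x) h2
      rwa [mul_one_div] at h3
    exact h1.comp_hasFDerivAt x (hc k)
  have hr : ∀ k, HasFDerivAt (fun y : Euc d => halfSq (-coordL d k y))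
      ((max (-coordL d k x) 0) • (-coordL d k)) x :=
    fun k => (hasDerivAt_halfSq _).comp_hasFDerivAt x (hc k).neg
  have hF := (hΦ 0).neg.add ((HasFDerivAt.fun_sum (u := Finset.range d)
    fun k _ => (hΨ k).mul (hΦ (k + 1))).neg.add
    (HasFDerivAt.fun_sum (u := Finset.range d) fun k _ => hr k))
  rw [hasGradientAt_iff_hasFDerivAt]
  refine hF.congr_fderiv ?_
  ext v
  have hin : (InnerProductSpace.toDual ℝ (Euc d)) (chainGrad x) v
      = ∑ k ∈ Finset.range d, chainPartial x k * coordL d k v := by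
    rw [Finset.sum_range, InnerProductSpace.toDual_apply_apply, PiLp.inner_apply]
    refine Finset.sum_congr rfl fun i _ => ?_
    rw [coordL_fin]
    simp [chainGrad, mul_comm]
  rw [hin]
  -- The index shift needs no boundary terms: `prevCoord` starts at `2`, where the step equals `1`,
  -- and the coordinate numbered `d` is zero.
  have hshift : tent (coordL d 0 x / 3 + 1) / 3 * coordL d 0 v
      + ∑ k ∈ Finset.range d, smoothStep (coordL d k x) *
        (tent (coordL d (k + 1) x / 3 + 1) / 3 * coordL d (k + 1) v)
      = ∑ k ∈ Finset.range d, smoothStep (prevCoord x k) *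
        (tent (coordL d k x / 3 + 1) / 3 * coordL d k v) := by
    have h1 := Finset.sum_range_succ (fun k => smoothStep (prevCoord x k) *
        (tent (coordL d k x / 3 + 1) / 3 * coordL d k v)) d
    have h2 := Finset.sum_range_succ' (fun k => smoothStep (prevCoord x k) *
        (tent (coordL d k x / 3 + 1) / 3 * coordL d k v)) d
    rw [h1] at h2
    have h3 : smoothStep (prevCoord x 0) = 1 := smoothStep_of_two_le le_rfl
    have h4 : coordL d d v = 0 := by rw [coordL_self]; rfl
    rw [h3, h4, mul_zero, mul_zero, add_zero, one_mul] at h2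
    rw [h2, add_comm]
    rfl
  simp only [add_apply, neg_apply,
    sum_apply, smul_apply, smul_eq_mul]
  have hexp : ∑ k ∈ Finset.range d, chainPartial x k * coordL d k v
      = -(∑ k ∈ Finset.range d, smoothStep (prevCoord x k) *
        (tent (coordL d k x / 3 + 1) / 3 * coordL d k v))
        - (∑ k ∈ Finset.range d, smoothStep (coordL d (k + 1) x / 3 + 1) *
          (tent (coordL d k x) * coordL d k v))
        + ∑ k ∈ Finset.range d, max (-coordL d k x) 0 * -coordL d k v := by
    rw [← Finset.sum_neg_distrib, ← Finset.sum_sub_distrib, ← Finset.sum_add_distrib]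
    refine Finset.sum_congr rfl fun k _ => ?_
    unfold chainPartial; ring
  rw [hexp, ← hshift, Finset.sum_add_distrib]
  ring

theorem abs_mul_sub_mul_le {a b a' b' : ℝ} {A B : ℝ} (ha : |a'| ≤ A) (hb : |b| ≤ B) :
    |a * b - a' * b'| ≤ B * |a - a'| + A * |b - b'| := by
  have h : a * b - a' * b' = b * (a - a') + a' * (b - b') := by ring
  rw [h]
  refine (abs_add_le _ _).trans ?_
  rw [abs_mul, abs_mul]
  gcongr

theorem abs_smoothStep_le (x : ℝ) : |smoothStep x| ≤ 1 := by
  rw [abs_of_nonneg (smoothStep_nonneg x)]; exact smoothStep_le_one x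

theorem abs_tent_le (x : ℝ) : |tent x| ≤ 1 := by
  rw [abs_of_nonneg (tent_nonneg x)]; exact tent_le_one x

/-- The three summands are Lipschitz by the product rule. The middle coefficient comes out as `1/9 +
1 + 1`; it is rounded up to `7/3` so that the three weights add up to `3`. -/
theorem abs_chainPartial_sub_le {d : ℕ} (x y : Euc d) (k : ℕ) :
    |chainPartial x k - chainPartial y k| ≤ 1 / 3 * |prevCoord x k - prevCoord y k|
      + 7 / 3 * |coordL d k (x - y)| + 1 / 3 * |coordL d (k + 1) (x - y)| := by
  simp only [map_sub]
  set p := prevCoord x k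
  set p' := prevCoord y k
  set u := coordL d k x
  set u' := coordL d k y
  set w := coordL d (k + 1) x
  set w' := coordL d (k + 1) y
  have hthird : ∀ z z' : ℝ, |z / 3 + 1 - (z' / 3 + 1)| = |z - z'| / 3 := fun z z' => by
    rw [show z / 3 + 1 - (z' / 3 + 1) = (z - z') / 3 by ring, abs_div, abs_of_pos (by norm_num : (0:ℝ) < 3)]
  have ht : |tent (u / 3 + 1) / 3| ≤ 1 / 3 := by
    rw [abs_div, abs_of_pos (by norm_num : (0:ℝ) < 3)]
    linarith [abs_tent_le (u / 3 + 1)]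
  have h1 : |smoothStep p * (tent (u / 3 + 1) / 3) - smoothStep p' * (tent (u' / 3 + 1) / 3)|
      ≤ 1 / 3 * |p - p'| + 1 / 9 * |u - u'| := by
    refine (abs_mul_sub_mul_le (abs_smoothStep_le p') ht).trans ?_
    have h2 := abs_smoothStep_sub_le p p'
    have h3 := abs_tent_sub_le (u / 3 + 1) (u' / 3 + 1)
    rw [hthird] at h3
    rw [← sub_div, abs_div, abs_of_pos (by norm_num : (0:ℝ) < 3)]
    linarith
  have h2 : |tent u * smoothStep (w / 3 + 1) - tent u' * smoothStep (w' / 3 + 1)|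
      ≤ |u - u'| + 1 / 3 * |w - w'| := by
    refine (abs_mul_sub_mul_le (abs_tent_le u') (abs_smoothStep_le _)).trans ?_
    have h3 := abs_smoothStep_sub_le (w / 3 + 1) (w' / 3 + 1)
    rw [hthird] at h3
    linarith [abs_tent_sub_le u u']
  have h3 : |max (-u) 0 - max (-u') 0| ≤ |u - u'| := by
    refine (abs_max_sub_max_le_abs _ _ _).trans (le_of_eq ?_)
    rw [abs_sub_comm]; congr 1; ring
  have h4 : chainPartial x k - chainPartial y k
      = -(smoothStep p * (tent (u / 3 + 1) / 3) - smoothStep p' * (tent (u' / 3 + 1) / 3))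
        - (tent u * smoothStep (w / 3 + 1) - tent u' * smoothStep (w' / 3 + 1))
        - (max (-u) 0 - max (-u') 0) := by
    simp only [chainPartial]; ring
  rw [h4]
  refine (abs_sub _ _).trans ?_
  refine (add_le_add_left (abs_sub _ _) _).trans ?_
  rw [abs_neg]
  linarith [abs_nonneg (u - u')]

/-- The gradient is tridiagonal in its dependence on the point. Cauchy–Schwarz with weights `1/3,
7/3, 1/3` gives the coefficients `1, 7, 1` for the squares, and their sum is `3 ^ 2`. -/
theorem norm_chainGrad_sub_le {d : ℕ} (x y : Euc d) :
    ‖chainGrad x - chainGrad y‖ ≤ 3 * ‖x - y‖ := by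
  have hsq : ∀ k, (chainPartial x k - chainPartial y k) ^ 2
      ≤ (prevCoord x k - prevCoord y k) ^ 2 + 7 * coordL d k (x - y) ^ 2
        + coordL d (k + 1) (x - y) ^ 2 := by
    intro k
    have h := abs_chainPartial_sub_le x y k
    rw [← sq_abs, ← sq_abs (prevCoord x k - prevCoord y k), ← sq_abs (coordL d k (x - y)),
      ← sq_abs (coordL d (k + 1) (x - y))]
    set a := |prevCoord x k - prevCoord y k|
    set b := |coordL d k (x - y)|
    set c := |coordL d (k + 1) (x - y)|
    refine (pow_le_pow_left₀ (abs_nonneg _) h 2).trans ?_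
    nlinarith [sq_nonneg (a - b), sq_nonneg (a - c), sq_nonneg (b - c)]
  have hnorm : ‖chainGrad x - chainGrad y‖ ^ 2
      = ∑ k ∈ Finset.range d, (chainPartial x k - chainPartial y k) ^ 2 := by
    rw [EuclideanSpace.norm_sq_eq, Finset.sum_range]
    simp [chainGrad]
  have hprev : ∑ k ∈ Finset.range d, (prevCoord x k - prevCoord y k) ^ 2 ≤ ‖x - y‖ ^ 2 := by
    rw [← sum_coordL_sq]
    have h1 := Finset.sum_range_succ (fun k => (prevCoord x k - prevCoord y k) ^ 2) d
    have h2 := Finset.sum_range_succ' (fun k => (prevCoord x k - prevCoord y k) ^ 2) d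
    have h3 : ∑ k ∈ Finset.range d, (prevCoord x (k + 1) - prevCoord y (k + 1)) ^ 2
        = ∑ k ∈ Finset.range d, coordL d k (x - y) ^ 2 :=
      Finset.sum_congr rfl fun k _ => by simp [prevCoord]
    rw [h3] at h2
    have h0 : (prevCoord x 0 - prevCoord y 0) ^ 2 = 0 := by simp [prevCoord]
    nlinarith [sq_nonneg (prevCoord x d - prevCoord y d)]
  have hnext : ∑ k ∈ Finset.range d, coordL d (k + 1) (x - y) ^ 2 ≤ ‖x - y‖ ^ 2 := by
    rw [← sum_coordL_sq]
    have h1 := Finset.sum_range_succ (fun k => coordL d k (x - y) ^ 2) d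
    have h2 := Finset.sum_range_succ' (fun k => coordL d k (x - y) ^ 2) d
    have h0 : coordL d d (x - y) ^ 2 = 0 := by simp [coordL_self]
    nlinarith [sq_nonneg (coordL d 0 (x - y))]
  have htot : ‖chainGrad x - chainGrad y‖ ^ 2 ≤ (3 * ‖x - y‖) ^ 2 := by
    rw [hnorm]
    refine (Finset.sum_le_sum fun k _ => hsq k).trans ?_
    rw [Finset.sum_add_distrib, Finset.sum_add_distrib, ← Finset.mul_sum, sum_coordL_sq]
    nlinarith
  exact le_of_sq_le_sq htot (by positivity)

theorem neg_le_chain {d : ℕ} (x : Euc d) : -((d : ℝ) + 1) ≤ chain d x := by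
  have h1 := smoothStep_le_one (coordL d 0 x / 3 + 1)
  have h2 : ∑ k ∈ Finset.range d,
      smoothStep (coordL d k x) * smoothStep (coordL d (k + 1) x / 3 + 1) ≤ d := by
    refine (Finset.sum_le_sum (g := fun _ => (1 : ℝ)) fun k _ => ?_).trans (by simp)
    exact mul_le_one₀ (smoothStep_le_one _) (smoothStep_nonneg _) (smoothStep_le_one _)
  have h3 : 0 ≤ ∑ k ∈ Finset.range d, halfSq (-coordL d k x) :=
    Finset.sum_nonneg fun k _ => by unfold halfSq; positivity
  unfold chain; linarith

theorem chain_zero_le (d : ℕ) : chain d 0 ≤ 0 := by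
  have h1 := smoothStep_nonneg 1
  simp only [chain, map_zero, smoothStep_zero]
  norm_num [halfSq, h1]

/-- The three terms of a partial derivative are all nonpositive, so they cannot cancel. At the first
coordinate `u` below `2` the preceding step equals `1`: for `-1 ≤ u < 2` the tent contributes at
least `1/9`, and for `u ≤ -1` the quadratic penalty takes over. -/
theorem one_ninth_le_norm_chainGrad {d : ℕ} (hd : 0 < d) (x : Euc d)
    (hx : x ⟨d - 1, Nat.sub_lt hd one_pos⟩ = 0) : 1 / 9 ≤ ‖chainGrad x‖ := by
  have hlast : coordL d (d - 1) x < 2 := by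
    have := coordL_fin (⟨d - 1, Nat.sub_lt hd one_pos⟩ : Fin d) x
    rw [hx] at this
    rw [show coordL d (d - 1) x = 0 from this]; norm_num
  have hex : ∃ k, coordL d k x < 2 := ⟨_, hlast⟩
  classical
  set k := Nat.find hex with hk
  have hk2 : coordL d k x < 2 := Nat.find_spec hex
  have hkd : k < d := lt_of_le_of_lt (Nat.find_min' hex hlast) (Nat.sub_lt hd one_pos)
  have hprev : smoothStep (prevCoord x k) = 1 := by
    apply smoothStep_of_two_le
    rcases hk' : k with _ | m
    · simp [prevCoord]
    · have := Nat.find_min hex (m := m) (by omega)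
      simpa [prevCoord] using this
  have hpart : 1 / 9 ≤ -chainPartial x k := by
    unfold chainPartial
    rw [hprev]
    set u := coordL d k x
    have h1 := le_tent (u / 3 + 1)
    have h2 := tent_nonneg (u / 3 + 1)
    have h3 := mul_nonneg (tent_nonneg u) (smoothStep_nonneg (coordL d (k + 1) x / 3 + 1))
    have h4 := le_max_left (-u) 0
    have h5 := le_max_right (-u) 0
    rw [show u / 3 + 1 - 1 = u / 3 by ring] at h1
    rcases abs_cases (u / 3) with ⟨h6, h7⟩ | ⟨h6, h7⟩
    · rw [h6] at h1; linarith
    · rw [h6] at h1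
      rcases le_total u (-1) with h8 | h8 <;> linarith
  have h := PiLp.norm_apply_le (chainGrad x) (⟨k, hkd⟩ : Fin d)
  have h' : chainGrad x ⟨k, hkd⟩ = chainPartial x k := rfl
  rw [h', Real.norm_eq_abs] at h
  linarith [neg_le_abs (chainPartial x k)]

/-- Both `tent` and the derivative of the penalty vanish at `0`, so only the coupling to the
preceding coordinate survives. -/
theorem chainGrad_apply_of_tail_zero {d : ℕ} (x : Euc d) (i : Fin d)
    (hx : ∀ j, i ≤ j → x j = 0) :
    chainGrad x i = -(smoothStep (prevCoord x i) * (tent 1 / 3)) := by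
  have h0 : coordL d i x = 0 := by rw [coordL_fin]; exact hx i le_rfl
  show chainPartial x i = _
  simp [chainPartial, h0, tent_zero]

theorem abs_chainGrad_apply_le {d : ℕ} (x : Euc d) (i : Fin d) (hx : ∀ j, i ≤ j → x j = 0) :
    |chainGrad x i| ≤ 1 := by
  rw [chainGrad_apply_of_tail_zero x i hx, abs_neg, abs_mul, abs_div]
  have h1 := abs_smoothStep_le (prevCoord x i)
  have h2 := abs_tent_le 1
  have h3 := abs_nonneg (tent 1)
  rw [abs_of_pos (by norm_num : (0:ℝ) < 3)]
  exact mul_le_one₀ h1 (by positivity) (by linarith)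

/-- The preceding coordinate also lies in the zero tail, and the step vanishes at `0`: this is what
makes the chain reveal one coordinate at a time. -/
theorem chainGrad_apply_eq_zero {d : ℕ} (x : Euc d) (i j : Fin d) (hj : j < i)
    (hx : ∀ l, j ≤ l → x l = 0) : chainGrad x i = 0 := by
  rw [chainGrad_apply_of_tail_zero x i fun l hl => hx l (hj.le.trans hl)]
  obtain ⟨i, hi⟩ := i
  obtain _ | m := i
  · exact absurd hj (by simp [Fin.lt_def])
  · have hm : m < d := by omega
    have h1 : coordL d m x = 0 := by
      rw [show coordL d m x = x ⟨m, hm⟩ from coordL_fin (⟨m, hm⟩ : Fin d) x]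
      apply hx
      rw [Fin.lt_def] at hj
      rw [Fin.le_def]
      simp only at hj ⊢
      omega
    simp [prevCoord, h1, smoothStep_zero]

/-- There is an `L`-smooth function whose gradient has norm at least `4 ε` unless the last
coordinate is active, and which reveals its coordinates one at a time. -/
theorem exists_smooth_chain {d : ℕ} (hd : 0 < d) {L ε : ℝ} (hL : 0 < L) (hε : 0 < ε) :
    ∃ f : Euc d → ℝ, IsLSmooth L f ∧ BddBelow (Set.range f) ∧
      f 0 - ⨅ x, f x ≤ 7776 * d * ε ^ 2 / L ∧
      (∀ x, x ⟨d - 1, Nat.sub_lt hd one_pos⟩ = 0 → 4 * ε ≤ ‖∇ f x‖) ∧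
      (∀ x i, (∀ j, i ≤ j → x j = 0) → |∇ f x i| ≤ 92 * ε) ∧
      (∀ x i j, j < i → (∀ l, j ≤ l → x l = 0) → ∇ f x i = 0) := by
  -- The scales solve two equations: `a * r = 36 * ε` turns the bound `1/9` into `4 * ε`, and `3 *
  -- (a * r) * r = L` is the smoothness. The gap is then at most `a * (d + 1) ≤ 2 * a * d`.
  set r : ℝ := L / (108 * ε) with hr
  have hr0 : 0 < r := by positivity
  set a : ℝ := 3888 * ε ^ 2 / L with ha
  have ha0 : 0 < a := by positivity
  have har : a * r = 36 * ε := by rw [ha, hr]; field_simp; norm_num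
  have hgrad : ∀ x, HasGradientAt (fun y => a * chain d (r • y)) ((36 * ε) • chainGrad (r • x)) x := by
    intro x
    have h1 := (hasGradientAt_chain (r • x)).hasFDerivAt
    have h2 : HasFDerivAt (fun y : Euc d => r • y) (r • ContinuousLinearMap.id ℝ (Euc d)) x :=
      (hasFDerivAt_id x).const_smul r
    have h3 := (h1.comp x h2).const_mul a
    rw [hasGradientAt_iff_hasFDerivAt]
    refine h3.congr_fderiv ?_
    ext v
    simp [← har, mul_assoc]
  have hg : ∀ x, ∇ (fun y => a * chain d (r • y)) x = (36 * ε) • chainGrad (r • x) :=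
    fun x => (hgrad x).gradient
  have hlow : ∀ x : Euc d, a * -((d : ℝ) + 1) ≤ a * chain d (r • x) :=
    fun x => mul_le_mul_of_nonneg_left (neg_le_chain _) ha0.le
  refine ⟨fun y => a * chain d (r • y), ⟨fun x => (hgrad x).hasFDerivAt.differentiableAt, ?_⟩,
    ⟨a * -((d : ℝ) + 1), ?_⟩, ?_, ?_, ?_, ?_⟩
  · intro x y
    rw [hg, hg, ← smul_sub, norm_smul, Real.norm_of_nonneg (by positivity)]
    have h1 := norm_chainGrad_sub_le (r • x) (r • y)
    rw [← smul_sub, norm_smul, Real.norm_of_nonneg hr0.le] at h1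
    calc 36 * ε * ‖chainGrad (r • x) - chainGrad (r • y)‖
        ≤ 36 * ε * (3 * (r * ‖x - y‖)) := by gcongr
      _ = L * ‖x - y‖ := by rw [hr]; field_simp; ring
  · rintro _ ⟨x, rfl⟩
    exact hlow x
  · have h1 : a * -((d : ℝ) + 1) ≤ ⨅ x, a * chain d (r • x) := le_ciInf hlow
    have h2 : a * chain d (r • 0) ≤ 0 := by
      rw [smul_zero]
      exact mul_nonpos_of_nonneg_of_nonpos ha0.le (chain_zero_le d)
    have h3 : (1 : ℝ) ≤ d := by exact_mod_cast hd
    have h4 : 7776 * (d : ℝ) * ε ^ 2 / L = a * (2 * d) := by rw [ha]; ring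
    rw [h4]
    nlinarith
  · intro x hx
    rw [hg, norm_smul, Real.norm_of_nonneg (by positivity)]
    have h1 := one_ninth_le_norm_chainGrad hd (r • x) (by simp [hx])
    nlinarith
  -- Here `36 * ε` would already do; `92 * ε` is the value that `gateProb` is built on.
  · intro x i hx
    rw [hg, PiLp.smul_apply, smul_eq_mul, abs_mul, abs_of_pos (by positivity : 0 < 36 * ε)]
    have h1 := abs_chainGrad_apply_le (r • x) i fun j hj => by simp [hx j hj]
    nlinarith
  · intro x i j hj hx
    rw [hg, PiLp.smul_apply,
      chainGrad_apply_eq_zero (r • x) i j hj fun l hl => by simp [hx l hl], smul_zero]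

end

/-! ### The coin-flip oracle: unbiasedness, moment bound, slow revelation -/

noncomputable section

/-- The Bernoulli law on `Bool` with probability `q` of `true`. -/
def coinLaw (q : ℝ) : Measure Bool :=
  ENNReal.ofReal q • Measure.dirac true + ENNReal.ofReal (1 - q) • Measure.dirac false

theorem isProbabilityMeasure_coinLaw {q : ℝ} (h0 : 0 ≤ q) (h1 : q ≤ 1) :
    IsProbabilityMeasure (coinLaw q) := by
  constructor
  simp only [coinLaw, Measure.add_apply, Measure.smul_apply, measure_univ, smul_eq_mul, mul_one]
  rw [← ENNReal.ofReal_add h0 (by linarith)]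
  simp

theorem lintegral_coinLaw (q : ℝ) (h : Bool → ℝ≥0∞) :
    ∫⁻ b, h b ∂coinLaw q = ENNReal.ofReal q * h true + ENNReal.ofReal (1 - q) * h false := by
  simp [coinLaw, lintegral_add_measure, lintegral_smul_measure]

theorem integrable_coinLaw {E : Type*} [NormedAddCommGroup E] (q : ℝ) (h : Bool → E) :
    Integrable h (coinLaw q) := by
  have hd : ∀ b : Bool, Integrable h (Measure.dirac b) := fun b =>
    integrable_dirac (by simp)
  exact ((hd true).smul_measure ENNReal.ofReal_ne_top).add_measure
    ((hd false).smul_measure ENNReal.ofReal_ne_top)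

theorem integral_coinLaw {E : Type*} [NormedAddCommGroup E] [NormedSpace ℝ E] [CompleteSpace E]
    {q : ℝ} (h0 : 0 ≤ q) (h1 : q ≤ 1) (h : Bool → E) :
    ∫ b, h b ∂coinLaw q = q • h true + (1 - q) • h false := by
  have hd : ∀ b : Bool, Integrable h (Measure.dirac b) := fun b =>
    integrable_dirac (by simp)
  rw [coinLaw, integral_add_measure ((hd true).smul_measure ENNReal.ofReal_ne_top)
    ((hd false).smul_measure ENNReal.ofReal_ne_top), integral_smul_measure, integral_smul_measure,
    integral_dirac, integral_dirac, ENNReal.toReal_ofReal h0,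
    ENNReal.toReal_ofReal (by linarith)]

open Classical in
/-- The estimator of `∇ f` which reveals the coordinates beyond the support of the point only
with probability `q`. -/
def gatedGradient {d : ℕ} (f : Euc d → ℝ) (q : ℝ) (x : Euc d) (b : Bool) : Euc d :=
  WithLp.toLp 2 fun i => if ∀ j, i ≤ j → x j = 0 then (if b then 1 / q else 0) * ∇ f x i else ∇ f x i

/-- The error lives on the zero tail of `x`, where by `hchain` at most one partial derivative is
nonzero. It is thus a multiple of one basis vector, and no factor depending on `d` appears. -/
theorem norm_gatedGradient_sub_le {d : ℕ} {f : Euc d → ℝ} {q M : ℝ} (hM : 0 ≤ M)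
    (hbound : ∀ x i, (∀ j, i ≤ j → x j = 0) → |∇ f x i| ≤ M)
    (hchain : ∀ x i j, j < i → (∀ l, j ≤ l → x l = 0) → ∇ f x i = 0) (x : Euc d) (b : Bool) :
    ‖gatedGradient f q x b - ∇ f x‖ ≤ M * |(if b then 1 / q else 0) - 1| := by
  set w : ℝ := (if b then 1 / q else 0) - 1 with hw
  set v := gatedGradient f q x b - ∇ f x with hv
  have happ : ∀ i, v i = if ∀ j, i ≤ j → x j = 0 then w * ∇ f x i else 0 := by
    intro i
    simp only [hv, gatedGradient, PiLp.sub_apply]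
    rw [hw]
    split_ifs <;> ring
  by_cases hex : ∃ i, v i ≠ 0
  · obtain ⟨i, hi⟩ := hex
    rw [happ] at hi
    have hgi : ∀ j, i ≤ j → x j = 0 := by
      by_contra h
      exact hi (if_neg h)
    rw [if_pos hgi] at hi
    have hne : ∇ f x i ≠ 0 := right_ne_zero_of_mul hi
    have hsingle : v = EuclideanSpace.single i (w * ∇ f x i) := by
      ext k
      rw [happ, PiLp.single_apply]
      by_cases hk : k = i
      · subst hk; simp only [if_pos hgi, if_true]
      · rw [if_neg hk]
        split_ifs with hgk
        · rcases lt_or_gt_of_ne hk with hlt | hgt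
          · exact absurd (hchain x i k hlt hgk) hne
          · rw [hchain x k i hgt hgi, mul_zero]
        · rfl
    rw [hsingle, PiLp.norm_single, Real.norm_eq_abs, abs_mul, mul_comm]
    exact mul_le_mul_of_nonneg_right (hbound x i hgi) (abs_nonneg _)
  · push Not at hex
    have : v = 0 := by ext i; simpa using hex i
    rw [this, norm_zero]
    positivity

theorem gateProb_pos {p σ ε : ℝ} (hσ : 0 < σ) (hε : 0 < ε) : 0 < gateProb p σ ε :=
  lt_min (by positivity) one_pos

theorem gateProb_le_one (p σ ε : ℝ) : gateProb p σ ε ≤ 1 := min_le_right _ _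

/-- If `q < 1`, each of the two terms is at most `(92 * ε) ^ p / q ^ (p - 1)`, and `q` is chosen to
make twice this equal to `σ ^ p`; hence the factor `2 ^ (1 / p)`. If `q = 1` there is no noise. -/
theorem gateProb_moment_le {p σ ε : ℝ} (hp : 1 < p) (hσ : 0 < σ) (hε : 0 < ε) :
    gateProb p σ ε * (92 * ε * |1 / gateProb p σ ε - 1|) ^ p
      + (1 - gateProb p σ ε) * (92 * ε) ^ p ≤ σ ^ p := by
  set q := gateProb p σ ε with hq
  have hq0 : 0 < q := gateProb_pos hσ hε
  have hp0 : p ≠ 0 := by linarith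
  rcases (gateProb_le_one p σ ε).lt_or_eq with h1 | h1
  · have hqdef : q = (92 * (2 : ℝ) ^ (1 / p) * ε / σ) ^ (p / (p - 1)) := by
      rcases min_choice ((92 * (2 : ℝ) ^ (1 / p) * ε / σ) ^ (p / (p - 1))) 1 with h | h
      · exact h
      · exact absurd h h1.ne
    rw [← hq] at h1
    have hb : (0 : ℝ) < 92 * (2 : ℝ) ^ (1 / p) * ε / σ := by positivity
    have hqp : q ^ (p - 1) = 2 * (92 * ε) ^ p / σ ^ p := by
      rw [hqdef, ← Real.rpow_mul hb.le, div_mul_cancel₀ _ (by linarith : p - 1 ≠ 0),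
        Real.div_rpow (by positivity) hσ.le,
        show 92 * (2 : ℝ) ^ (1 / p) * ε = (2 : ℝ) ^ (1 / p) * (92 * ε) by ring,
        Real.mul_rpow (by positivity) (by positivity), ← Real.rpow_mul (by norm_num),
        one_div_mul_cancel hp0, Real.rpow_one]
    have hinv : 1 ≤ 1 / q := by rw [le_div_iff₀ hq0]; linarith
    have habs : |1 / q - 1| ≤ 1 / q := by rw [abs_of_nonneg (by linarith)]; linarith
    have h2 : q * (1 / q) ^ p = 1 / q ^ (p - 1) := by
      rw [Real.div_rpow zero_le_one hq0.le, Real.one_rpow, Real.rpow_sub_one hq0.ne']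
      field_simp
    have h3 : q ^ (p - 1) ≤ 1 := Real.rpow_le_one hq0.le h1.le (by linarith)
    have h4 : (0 : ℝ) < q ^ (p - 1) := by positivity
    have h5 : 1 - q ≤ 1 / q ^ (p - 1) := by
      rw [le_div_iff₀ h4]; nlinarith
    have hX : (0 : ℝ) < (92 * ε) ^ p := by positivity
    have hS : (0 : ℝ) < σ ^ p := by positivity
    calc q * (92 * ε * |1 / q - 1|) ^ p + (1 - q) * (92 * ε) ^ p
        ≤ q * (92 * ε * (1 / q)) ^ p + 1 / q ^ (p - 1) * (92 * ε) ^ p := by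
          gcongr
      _ = 2 * (92 * ε) ^ p * (1 / q ^ (p - 1)) := by
          rw [Real.mul_rpow (by positivity) (by positivity), mul_left_comm, h2]; ring
      _ = σ ^ p := by rw [hqp]; field_simp
  · rw [← hq] at h1
    rw [h1]
    norm_num [Real.zero_rpow hp0]
    positivity

theorem isPBCMOracle_gatedGradient {d : ℕ} {f : Euc d → ℝ} {p σ ε : ℝ} (hp : 1 < p) (hσ : 0 < σ)
    (hε : 0 < ε) (hbound : ∀ x i, (∀ j, i ≤ j → x j = 0) → |∇ f x i| ≤ 92 * ε)
    (hchain : ∀ x i j, j < i → (∀ l, j ≤ l → x l = 0) → ∇ f x i = 0) :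
    IsPBCMOracle f (coinLaw (gateProb p σ ε)) (gatedGradient f (gateProb p σ ε)) p σ := by
  have hq0 := gateProb_pos (p := p) hσ hε
  have hq1 := gateProb_le_one p σ ε
  refine ⟨fun x => integrable_coinLaw _ _, fun x => ?_, fun x => ?_⟩
  · rw [integral_coinLaw hq0.le hq1]
    ext i
    simp only [gatedGradient, PiLp.add_apply, PiLp.smul_apply, smul_eq_mul]
    simp only [if_true, Bool.false_eq_true, if_false]
    split_ifs
    · field_simp
      ring
    · ring
  · rw [lintegral_coinLaw]
    have hterm : ∀ b, ‖gatedGradient f (gateProb p σ ε) x b - ∇ f x‖ₑ ^ p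
        ≤ ENNReal.ofReal ((92 * ε * |(if b then 1 / gateProb p σ ε else 0) - 1|) ^ p) := by
      intro b
      have hp0 : 0 ≤ p := by linarith
      rw [← ofReal_norm, ENNReal.ofReal_rpow_of_nonneg (norm_nonneg _) hp0]
      exact ENNReal.ofReal_le_ofReal (Real.rpow_le_rpow (norm_nonneg _)
        (norm_gatedGradient_sub_le (by positivity) hbound hchain x b) hp0)
    refine (add_le_add (mul_le_mul_right (hterm true) _)
      (mul_le_mul_right (hterm false) _)).trans ?_
    rw [← ENNReal.ofReal_mul hq0.le, ← ENNReal.ofReal_mul (by linarith),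
      ← ENNReal.ofReal_add (by positivity) (mul_nonneg (by linarith) (by positivity))]
    refine ENNReal.ofReal_le_ofReal (le_trans (le_of_eq ?_) (gateProb_moment_le hp hσ hε))
    simp

theorem gatedGradient_apply_eq_zero {d : ℕ} {f : Euc d → ℝ} {q : ℝ}
    (hchain : ∀ x i j, j < i → (∀ l, j ≤ l → x l = 0) → ∇ f x i = 0) {x : Euc d} {m : ℕ}
    (hx : ∀ j : Fin d, m ≤ j → x j = 0) (b : Bool) (i : Fin d)
    (hi : m + (if b = true then 1 else 0) ≤ (i : ℕ)) : gatedGradient f q x b i = 0 := by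
  have hm : m ≤ (i : ℕ) := (Nat.le_add_right _ _).trans hi
  have hgate : ∀ j, i ≤ j → x j = 0 := fun j hj => hx j (hm.trans hj)
  show (if _ then _ else _) = _
  rw [if_pos hgate]
  cases b
  · simp
  · simp only [if_true] at hi ⊢
    have hmd : m < d := by have := i.2; omega
    rw [hchain x i ⟨m, hmd⟩ (by rw [Fin.lt_def]; simp only; omega) (fun l hl => hx l hl), mul_zero]

end

/-! ### Concentration for predictably chosen coin flips -/

noncomputable section

open Classical in
/-- The number of rounds `j < k` at which the predicate `C` holds. -/
def trialCount (C : ℕ → (ℕ → Bool) → Prop) (k : ℕ) (b : ℕ → Bool) : ℕ :=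
  ∑ j ∈ Finset.range k, if C j b then 1 else 0

open Classical in
/-- The number of rounds `j < k` at which the predicate `C` holds and the sample is `true`. -/
def successCount (C : ℕ → (ℕ → Bool) → Prop) (k : ℕ) (b : ℕ → Bool) : ℕ :=
  ∑ j ∈ Finset.range k, if C j b ∧ b j = true then 1 else 0

/-- `φ b` depends on the first `k` entries of `b` only. -/
def DependsOnPrefix {α : Type*} (k : ℕ) (φ : (ℕ → Bool) → α) : Prop :=
  ∀ b b', (∀ j < k, b j = b' j) → φ b = φ b'

/-- A function of finitely many bits factors through a finite discrete space, so it is measurable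
whatever it is. No measurability of the maps of the algorithm is therefore needed. -/
theorem DependsOnPrefix.exists_factor {α : Type*} {k : ℕ} {φ : (ℕ → Bool) → α}
    (h : DependsOnPrefix k φ) :
    ∃ ψ : (Finset.range k → Bool) → α, ∀ b, φ b = ψ fun j => b j := by
  refine ⟨fun c => φ fun j => if hj : j ∈ Finset.range k then c ⟨j, hj⟩ else false, fun b => ?_⟩
  refine h _ _ fun j hj => ?_
  simp [hj]

theorem DependsOnPrefix.measurable {Ω α : Type*} [MeasurableSpace Ω] [MeasurableSpace α] {k : ℕ}
    {φ : (ℕ → Bool) → α} (h : DependsOnPrefix k φ) {ξ : ℕ → Ω → Bool}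
    (hξ : ∀ j, Measurable (ξ j)) : Measurable fun ω => φ fun j => ξ j ω := by
  obtain ⟨ψ, hψ⟩ := h.exists_factor
  simp only [hψ]
  exact (measurable_of_finite ψ).comp (measurable_pi_lambda _ fun j => hξ j)

theorem DependsOnPrefix.indepFun {Ω α : Type*} [MeasurableSpace Ω] {P : Measure Ω}
    [MeasurableSpace α] {k : ℕ} {φ : (ℕ → Bool) → α} (h : DependsOnPrefix k φ)
    {ξ : ℕ → Ω → Bool} (hξ : ∀ j, Measurable (ξ j)) (hind : iIndepFun ξ P) :
    IndepFun (fun ω => φ fun j => ξ j ω) (ξ k) P := by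
  obtain ⟨ψ, hψ⟩ := h.exists_factor
  simp only [hψ]
  have h1 := hind.indepFun_finset (Finset.range k) {k} (by simp) hξ
  exact h1.comp (measurable_of_finite ψ) (measurable_pi_apply (⟨k, by simp⟩ : ({k} : Finset ℕ)))

theorem dependsOnPrefix_successCount {C : ℕ → (ℕ → Bool) → Prop}
    (hC : ∀ j, DependsOnPrefix j (C j)) (k : ℕ) : DependsOnPrefix k (successCount C k) := by
  classical
  intro b b' h
  refine Finset.sum_congr rfl fun j hj => ?_
  rw [Finset.mem_range] at hj
  rw [hC j b b' fun l hl => h l (hl.trans hj), h j hj]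

theorem dependsOnPrefix_trialCount {C : ℕ → (ℕ → Bool) → Prop}
    (hC : ∀ j, DependsOnPrefix j (C j)) (k : ℕ) : DependsOnPrefix k (trialCount C k) := by
  classical
  intro b b' h
  refine Finset.sum_congr rfl fun j hj => ?_
  rw [Finset.mem_range] at hj
  rw [hC j b b' fun l hl => h l (hl.trans hj)]

/-- The exponential supermartingale of a sequence of coin flips with a predictable choice of the
rounds that count. -/
theorem lintegral_exp_successCount_le {Ω : Type*} [MeasurableSpace Ω] {P : Measure Ω}
    [IsProbabilityMeasure P] {ξ : ℕ → Ω → Bool} (hξ : ∀ j, Measurable (ξ j))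
    (hind : iIndepFun ξ P) {q : ℝ} (hq0 : 0 ≤ q) (hq1 : q ≤ 1)
    (hlaw : ∀ j, P.map (ξ j) = coinLaw q) {C : ℕ → (ℕ → Bool) → Prop}
    (hC : ∀ j, DependsOnPrefix j (C j)) {a r : ℝ}
    (har : q * Real.exp a + (1 - q) ≤ Real.exp r) (k : ℕ) :
    ∫⁻ ω, ENNReal.ofReal (Real.exp (a * successCount C k (fun j => ξ j ω)
      - r * trialCount C k (fun j => ξ j ω))) ∂P ≤ 1 := by
  classical
  induction k with
  | zero => simp [successCount, trialCount]
  | succ k ih =>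
    set Z : (ℕ → Bool) → ℝ≥0∞ := fun b =>
      ENNReal.ofReal (Real.exp (a * successCount C k b - r * trialCount C k b)) with hZ
    set Y : Bool → ℝ≥0∞ := fun c =>
      ENNReal.ofReal (Real.exp ((if c = true then a else 0) - r)) with hY
    -- Split by whether round `k` counts. Only the counted part picks up the factor `Y`, of mean at
    -- most `1` by `har`, and that part is independent of the `k`-th sample.
    set Z₀ : (ℕ → Bool) → ℝ≥0∞ := fun b => if C k b then 0 else Z b with hZ0
    set Z₁ : (ℕ → Bool) → ℝ≥0∞ := fun b => if C k b then Z b else 0 with hZ1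
    have hZdep : DependsOnPrefix k Z := fun b b' h => by
      simp only [hZ, dependsOnPrefix_successCount hC k b b' h,
        dependsOnPrefix_trialCount hC k b b' h]
    have hZ0dep : DependsOnPrefix k Z₀ := fun b b' h => by
      simp only [hZ0, hZdep b b' h, hC k b b' h]
    have hZ1dep : DependsOnPrefix k Z₁ := fun b b' h => by
      simp only [hZ1, hZdep b b' h, hC k b b' h]
    have hstep : ∀ b : ℕ → Bool, ENNReal.ofReal (Real.exp (a * successCount C (k + 1) b
        - r * trialCount C (k + 1) b)) = Z₀ b + Z₁ b * Y (b k) := by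
      intro b
      have hs : successCount C (k + 1) b
          = successCount C k b + if C k b ∧ b k = true then 1 else 0 :=
        Finset.sum_range_succ _ _
      have ht : trialCount C (k + 1) b = trialCount C k b + if C k b then 1 else 0 :=
        Finset.sum_range_succ _ _
      rw [hs, ht]
      by_cases hc : C k b
      · simp only [hZ0, hZ1, hY, hZ, hc, if_true, true_and, zero_add]
        rw [← ENNReal.ofReal_mul (Real.exp_pos _).le, ← Real.exp_add]
        congr 2
        split_ifs <;> push_cast <;> ring
      · simp [hZ0, hZ1, hZ, hc]
    have hYint : ∫⁻ ω, Y (ξ k ω) ∂P ≤ 1 := by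
      rw [← lintegral_map (measurable_of_finite Y) (hξ k), hlaw, lintegral_coinLaw]
      simp only [hY, if_true, Bool.false_eq_true, if_false]
      rw [← ENNReal.ofReal_mul hq0, ← ENNReal.ofReal_mul (by linarith),
        ← ENNReal.ofReal_add (by positivity) (mul_nonneg (by linarith) (Real.exp_pos _).le)]
      rw [ENNReal.ofReal_le_one]
      have h1 : q * Real.exp (a - r) + (1 - q) * Real.exp (0 - r)
          = (q * Real.exp a + (1 - q)) / Real.exp r := by
        rw [Real.exp_sub, Real.exp_sub, Real.exp_zero]; ring
      rw [h1]
      exact (div_le_one (Real.exp_pos _)).2 har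
    simp only [hstep]
    have hmul : ∫⁻ ω, Z₁ (fun j => ξ j ω) * Y (ξ k ω) ∂P
        = (∫⁻ ω, Z₁ (fun j => ξ j ω) ∂P) * ∫⁻ ω, Y (ξ k ω) ∂P :=
      lintegral_mul_eq_lintegral_mul_lintegral_of_indepFun'' (hZ1dep.measurable hξ).aemeasurable
      ((measurable_of_finite Y).comp (hξ k)).aemeasurable
      ((hZ1dep.indepFun hξ hind).comp measurable_id (measurable_of_finite Y))
    rw [lintegral_add_left (hZ0dep.measurable hξ), hmul]
    calc (∫⁻ ω, Z₀ (fun j => ξ j ω) ∂P) + (∫⁻ ω, Z₁ (fun j => ξ j ω) ∂P) * ∫⁻ ω, Y (ξ k ω) ∂P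
        ≤ (∫⁻ ω, Z₀ (fun j => ξ j ω) ∂P) + (∫⁻ ω, Z₁ (fun j => ξ j ω) ∂P) * 1 := by gcongr
      _ = ∫⁻ ω, Z (fun j => ξ j ω) ∂P := by
          rw [mul_one, ← lintegral_add_left (hZ0dep.measurable hξ)]
          refine lintegral_congr fun ω => ?_
          simp only [hZ0, hZ1]
          split_ifs <;> simp
      _ ≤ 1 := ih

/-- If at most `m` rounds count, then `T` successes occur with probability at most
`exp (r m - a T)`. -/
theorem measure_exists_le_successCount_le {Ω : Type*} [MeasurableSpace Ω] {P : Measure Ω}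
    [IsProbabilityMeasure P] {ξ : ℕ → Ω → Bool} (hξ : ∀ j, Measurable (ξ j))
    (hind : iIndepFun ξ P) {q : ℝ} (hq0 : 0 ≤ q) (hq1 : q ≤ 1)
    (hlaw : ∀ j, P.map (ξ j) = coinLaw q) {C : ℕ → (ℕ → Bool) → Prop}
    (hC : ∀ j, DependsOnPrefix j (C j)) {a r : ℝ} (ha : 0 ≤ a) (hr : 0 ≤ r)
    (har : q * Real.exp a + (1 - q) ≤ Real.exp r) {m T : ℕ} (hm : ∀ k b, trialCount C k b ≤ m) :
    MeasurableSet {ω | ∃ k, T ≤ successCount C k (fun j => ξ j ω)} ∧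
    P {ω | ∃ k, T ≤ successCount C k (fun j => ξ j ω)} ≤ ENNReal.ofReal (Real.exp (r * m - a * T)) := by
  classical
  have hmeas : ∀ k, MeasurableSet {ω | T ≤ successCount C k (fun j => ξ j ω)} := fun k =>
    measurableSet_le measurable_const ((dependsOnPrefix_successCount hC k).measurable hξ)
  have hset : {ω | ∃ k, T ≤ successCount C k (fun j => ξ j ω)}
      = ⋃ k, {ω | T ≤ successCount C k (fun j => ξ j ω)} := by ext; simp
  rw [hset]
  refine ⟨MeasurableSet.iUnion hmeas, ?_⟩
  -- Success counts never decrease, so the measure of the union is the supremum over `k`, and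
  -- Markov's inequality at each fixed `k` suffices.
  have hmono : Monotone fun k => {ω | T ≤ successCount C k (fun j => ξ j ω)} := by
    refine monotone_nat_of_le_succ fun k ω hω => ?_
    refine le_trans (Set.mem_ofPred_eq ▸ hω) ?_
    exact Finset.sum_le_sum_of_subset (Finset.range_mono (Nat.le_succ k))
  rw [hmono.measure_iUnion]
  refine iSup_le fun k => ?_
  have hint := lintegral_exp_successCount_le hξ hind hq0 hq1 hlaw hC har k
  set e := ENNReal.ofReal (Real.exp (a * T - r * m)) with he
  have hle : e * P {ω | T ≤ successCount C k (fun j => ξ j ω)} ≤ 1 := by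
    refine le_trans ?_ hint
    rw [← lintegral_indicator_const (hmeas k)]
    refine lintegral_mono fun ω => ?_
    refine Set.indicator_apply_le' (fun hω => ?_) fun _ => zero_le
    refine ENNReal.ofReal_le_ofReal (Real.exp_le_exp.2 ?_)
    have h1 : (T : ℝ) ≤ successCount C k (fun j => ξ j ω) := by exact_mod_cast hω
    have h2 : (trialCount C k (fun j => ξ j ω) : ℝ) ≤ m := by exact_mod_cast hm k _
    nlinarith
  have hinv : ENNReal.ofReal (Real.exp (r * m - a * T)) * e = 1 := by
    rw [he, ← ENNReal.ofReal_mul (Real.exp_pos _).le, ← Real.exp_add]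
    ring_nf
    simp
  calc P {ω | T ≤ successCount C k (fun j => ξ j ω)}
      = ENNReal.ofReal (Real.exp (r * m - a * T)) * (e * P {ω | T ≤ successCount C k (fun j => ξ j ω)}) := by
        rw [← mul_assoc, hinv, one_mul]
    _ ≤ ENNReal.ofReal (Real.exp (r * m - a * T)) * 1 := by gcongr
    _ = _ := mul_one _

end

/-! ### Cumulative work and the epoch times -/

noncomputable section

theorem work_mono {υ : ℝ → ℝ} (h : IsComputationPower υ) : Monotone (work υ) := by
  intro s t hst
  have hst' : (s : ℝ) ≤ t := hst
  have h1 := intervalIntegral.integral_add_adjacent_intervals (h.integrable s s.2)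
    ((h.integrable s s.2).symm.trans (h.integrable t t.2))
  have h2 : 0 ≤ ∫ τ in (s : ℝ)..t, υ τ :=
    intervalIntegral.integral_nonneg hst' fun u hu => h.nonneg u (s.2.trans hu.1)
  unfold work
  linarith

theorem work_zero (υ : ℝ → ℝ) : work υ 0 = 0 := by simp [work]

theorem work_nonneg {υ : ℝ → ℝ} (h : IsComputationPower υ) (t : ℝ≥0) : 0 ≤ work υ t := by
  rw [← work_zero υ]; exact work_mono h zero_le

theorem continuous_work {υ : ℝ → ℝ} (h : IsComputationPower υ) : Continuous (work υ) := by
  rw [continuous_iff_continuousAt]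
  intro t
  have h1 : ContinuousWithinAt (fun s : ℝ => ∫ τ in (0 : ℝ)..s, υ τ) (Set.Icc 0 (t + 1)) t := by
    refine intervalIntegral.continuousWithinAt_primitive (by simp) ?_
    have h2 : (0 : ℝ) ≤ t + 1 := by positivity
    rw [min_eq_left le_rfl, max_eq_right h2]
    exact h.integrable _ h2
  have h3 : Filter.Tendsto (fun s : ℝ≥0 => (s : ℝ)) (nhds t)
      (nhdsWithin (t : ℝ) (Set.Icc 0 ((t : ℝ) + 1))) := by
    refine tendsto_nhdsWithin_iff.2 ⟨NNReal.continuous_coe.continuousAt, ?_⟩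
    have h4 : ∀ᶠ s : ℝ≥0 in nhds t, s < t + 1 := Iio_mem_nhds (lt_add_one t)
    filter_upwards [h4] with s hs
    exact ⟨s.2, by exact_mod_cast hs.le⟩
  exact h1.tendsto.comp h3

/-- Up to the epoch time `T_K`, the workers do at most `K N` units of work. -/
theorem sum_work_le_of_le_epochTime {n : ℕ} {υ : Fin n → ℝ → ℝ}
    (hυ : ∀ i, IsComputationPower (υ i)) (N : ℕ) (K : ℕ) (t : ℝ≥0)
    (ht : (t : ℝ≥0∞) ≤ epochTime υ N K) : ∑ i, work (υ i) t ≤ K * N := by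
  induction K generalizing t with
  | zero =>
    have h0 : t = 0 := by simpa [epochTime] using ht
    simp [h0, work_zero]
  | succ K ih =>
    by_cases htop : epochTime υ N K = ∞
    · refine (ih t (by rw [htop]; exact le_top)).trans ?_
      push_cast
      nlinarith [Nat.cast_nonneg (α := ℝ) N]
    · set T := (epochTime υ N K).toNNReal with hT
      have hTK : (T : ℝ≥0∞) = epochTime υ N K := ENNReal.coe_toNNReal htop
      have hW := ih T hTK.le
      -- At the infimum itself the defining inequality may already hold, so the bound is proved
      -- strictly before `t` and carried over by continuity from the left.
      have hlt : ∀ s : ℝ≥0, s < t → ∑ i, work (υ i) s ≤ (K + 1 : ℕ) * N := by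
        intro s hs
        by_contra hcon
        push Not at hcon
        have hmem : (s : ℝ≥0∞) ∈ {S : ℝ≥0∞ | epochTime υ N K ≠ ∞ ∧ ∃ T : ℝ≥0, S = T ∧
            (N : ℝ) ≤ ∑ i, ∫ τ in (epochTime υ N K).toReal..(T : ℝ), υ i τ} := by
          refine ⟨htop, s, rfl, ?_⟩
          have h1 : ∀ i, ∫ τ in (epochTime υ N K).toReal..(s : ℝ), υ i τ
              = work (υ i) s - work (υ i) T := by
            intro i
            unfold work
            rw [intervalIntegral.integral_interval_sub_left ((hυ i).integrable s s.2)
              ((hυ i).integrable T T.2)]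
            rfl
          simp only [h1, Finset.sum_sub_distrib]
          push_cast at hcon
          linarith
        have h2 : epochTime υ N (K + 1) ≤ s := sInf_le hmem
        have h3 := ht.trans h2
        exact absurd (by exact_mod_cast h3 : t ≤ s) (not_le.2 hs)
      rcases eq_or_ne t 0 with rfl | h0
      · simp only [work_zero, Finset.sum_const_zero]; positivity
      · have hcont : Continuous fun s => ∑ i, work (υ i) s :=
          continuous_finsetSum _ fun i _ => continuous_work (hυ i)
        have hne : (nhdsWithin t (Set.Iio t)).NeBot :=
          nhdsLT_neBot_of_exists_lt ⟨0, pos_iff_ne_zero.2 h0⟩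
        refine le_of_tendsto (hcont.continuousWithinAt (s := Set.Iio t) (x := t)) ?_
        filter_upwards [self_mem_nhdsWithin] with s hs
        exact hlt s hs

/-! ### Dynamics of an algorithm: revealed coordinates and work spent -/

namespace AsyncAlgorithm

variable {n d : ℕ} (A : AsyncAlgorithm n d) (υ : Fin n → ℝ → ℝ) (G : Euc d → Bool → Euc d)

theorem dependsOnPrefix_run (k : ℕ) : DependsOnPrefix k fun b => A.run υ G b k := by
  induction k with
  | zero => intro b b' _; rfl
  | succ k ih =>
    intro b b' h
    have h1 := ih b b' fun j hj => h j (hj.trans (Nat.lt_succ_self k))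
    have h2 := h k (Nat.lt_succ_self k)
    simp only at h1
    simp only [run, h1, h2]

theorem clock_le_clock_succ (b : ℕ → Bool) (k : ℕ) :
    A.clock υ G b k ≤ A.clock υ G b (k + 1) := by
  rcases k with _ | k
  · exact zero_le
  · have h := A.time_mono k (A.run υ G b (k + 1)).1
    have h2 : (fun s : Fin k => (A.run υ G b (k + 1)).1 s.castSucc) = (A.run υ G b k).1 := by
      funext s
      simp [run]
    rwa [h2] at h

/-- The worker called in round `k`. -/
def calledWorker (b : ℕ → Bool) (k : ℕ) : Fin n := (A.query k (A.run υ G b k).1).worker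

/-- In round `k`, at a time not later than `t`, the called worker returns a stochastic gradient. -/
def Completes (t : ℝ≥0) (k : ℕ) (b : ℕ → Bool) : Prop :=
  ((A.run υ G b k).2 (A.calledWorker υ G b k)).busy = true ∧
  1 ≤ work (υ (A.calledWorker υ G b k)) (A.clock υ G b (k + 1))
    - work (υ (A.calledWorker υ G b k))
      ((A.run υ G b k).2 (A.calledWorker υ G b k)).startTime ∧
  A.clock υ G b (k + 1) ≤ t

/-- Predictability: whether round `k` returns a gradient is settled by the history, before the
sample of that round is used. -/
theorem dependsOnPrefix_completes (t : ℝ≥0) (k : ℕ) :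
    DependsOnPrefix k (A.Completes υ G t k) := by
  intro b b' h
  have h1 := A.dependsOnPrefix_run υ G k b b' h
  simp only at h1
  simp only [Completes, calledWorker, clock, h1]

open Classical in
/-- The number of stochastic gradients returned by worker `i` in the first `k` rounds. -/
def workerCount (t : ℝ≥0) (k : ℕ) (b : ℕ → Bool) (i : Fin n) : ℕ :=
  ∑ j ∈ Finset.range k, if A.Completes υ G t j b ∧ A.calledWorker υ G b j = i then 1 else 0

theorem sum_workerCount (t : ℝ≥0) (k : ℕ) (b : ℕ → Bool) :
    ∑ i, A.workerCount υ G t k b i = trialCount (A.Completes υ G t) k b := by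
  classical
  unfold workerCount trialCount
  rw [Finset.sum_comm]
  refine Finset.sum_congr rfl fun j _ => ?_
  by_cases h : A.Completes υ G t j b <;> simp [h]

/-- Before time `t`, each success reveals at most one new coordinate, and each gradient returned by
a worker takes a unit of its work. -/
theorem run_invariant {υ} (hυ : ∀ i, IsComputationPower (υ i)) {G}
    (hG : ∀ (x : Euc d) (m : ℕ), (∀ j : Fin d, m ≤ j → x j = 0) → ∀ (c : Bool) (i : Fin d),
      m + (if c = true then 1 else 0) ≤ (i : ℕ) → G x c i = 0)
    (t : ℝ≥0) (b : ℕ → Bool) (k : ℕ) (hk : A.clock υ G b k ≤ t) :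
    (∀ (s : Fin k) (j : Fin d), successCount (A.Completes υ G t) k b ≤ j →
      (A.run υ G b k).1 s j = 0) ∧
    (∀ i, (A.workerCount υ G t k b i : ℝ) ≤ work (υ i) (A.clock υ G b k)) ∧
    (∀ i, ((A.run υ G b k).2 i).busy = true →
      (∀ j : Fin d, successCount (A.Completes υ G t) k b ≤ j →
        ((A.run υ G b k).2 i).point j = 0) ∧
      (A.workerCount υ G t k b i : ℝ) ≤ work (υ i) ((A.run υ G b k).2 i).startTime) := by
  classical
  induction k with
  | zero =>
    refine ⟨fun s => s.elim0, fun i => ?_, fun i hi => ?_⟩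
    · simpa [workerCount] using work_nonneg (hυ i) _
    · simp [run, WorkerState.idle] at hi
  | succ k ih =>
    have hmono := A.clock_le_clock_succ υ G b k
    obtain ⟨ihg, ihw, ihs⟩ := ih (hmono.trans hk)
    set S := successCount (A.Completes υ G t) k b with hS
    set w := A.calledWorker υ G b k with hw
    set st := (A.run υ G b k).2 w with hst
    set a := A.query k (A.run υ G b k).1 with ha
    set r := universalOracle (work (υ w)) G a.time a.point st (b k) with hr
    have hrun1 : (A.run υ G b (k + 1)).1
        = Fin.snoc (α := fun _ => Euc d) (A.run υ G b k).1 r.2 := rfl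
    have hrun2 : (A.run υ G b (k + 1)).2 = Function.update (A.run υ G b k).2 w r.1 := rfl
    have hclock : A.clock υ G b (k + 1) = a.time := rfl
    have hsucc : successCount (A.Completes υ G t) (k + 1) b
        = S + if A.Completes υ G t k b ∧ b k = true then 1 else 0 := Finset.sum_range_succ _ _
    have hcount : ∀ i, A.workerCount υ G t (k + 1) b i = A.workerCount υ G t k b i
        + if A.Completes υ G t k b ∧ w = i then 1 else 0 := fun i => Finset.sum_range_succ _ _
    have hSle : S ≤ successCount (A.Completes υ G t) (k + 1) b := by
      rw [hsucc]; exact Nat.le_add_right _ _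
    have hpoint : ∀ j : Fin d, S ≤ j → a.point j = 0 := by
      intro j hj
      by_contra hne
      obtain ⟨s, hs⟩ := A.supp_subset k _ j hne
      exact hs (ihg s j hj)
    have hworkmono : ∀ i, work (υ i) (A.clock υ G b k) ≤ work (υ i) (A.clock υ G b (k + 1)) :=
      fun i => work_mono (hυ i) hmono
    have hother : ∀ i, i ≠ w → A.workerCount υ G t (k + 1) b i = A.workerCount υ G t k b i :=
      fun i hi => by rw [hcount, if_neg (fun h => hi h.2.symm), add_zero]
    have hg : ∀ j : Fin d, successCount (A.Completes υ G t) (k + 1) b ≤ j → r.2 j = 0 := by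
      intro j hj
      rw [hr, universalOracle]
      split_ifs with h1 h2
      · rfl
      · rfl
      · have hbusy : st.busy = true := by simpa using h1
        have hC : A.Completes υ G t k b := ⟨hbusy, not_lt.1 h2, hk⟩
        rw [hsucc] at hj
        simp only [hC, true_and] at hj
        exact hG st.point S (ihs w hbusy).1 (b k) j hj
    -- All earlier gradients of `w` were paid for by its start time, and a completion requires one
    -- more unit of work since then.
    have hown : (A.workerCount υ G t (k + 1) b w : ℝ) ≤ work (υ w) (A.clock υ G b (k + 1)) := by
      rw [hcount]
      by_cases hC : A.Completes υ G t k b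
      · have h1 := (ihs w hC.1).2
        have h2 := hC.2.1
        simp only [hC, true_and, if_true]
        push_cast
        linarith
      · simp only [hC, false_and, if_false, add_zero]
        exact (ihw w).trans (hworkmono w)
    have hstate : r.1.busy = true →
        (∀ j : Fin d, successCount (A.Completes υ G t) (k + 1) b ≤ j → r.1.point j = 0) ∧
        (A.workerCount υ G t (k + 1) b w : ℝ) ≤ work (υ w) r.1.startTime := by
      rw [hr, universalOracle]
      split_ifs with h1 h2
      -- The new start time is the current clock, so `hown` is the required bound.
      · exact fun _ => ⟨fun j hj => hpoint j (hSle.trans hj), hown⟩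
      · intro _
        have hbusy : st.busy = true := by simpa using h1
        have hC : ¬ A.Completes υ G t k b := fun h => absurd h2 (not_lt.2 h.2.1)
        refine ⟨fun j hj => (ihs w hbusy).1 j (hSle.trans hj), ?_⟩
        rw [hcount, if_neg (fun h => hC h.1), add_zero]
        exact (ihs w hbusy).2
      · intro h; simp [WorkerState.idle] at h
    refine ⟨fun s j hj => ?_, fun i => ?_, fun i hi => ?_⟩
    · rw [hrun1]
      induction s using Fin.lastCases with
      | last => rw [Fin.snoc_last]; exact hg j hj
      | cast s => rw [Fin.snoc_castSucc]; exact ihg s j (hSle.trans hj)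
    · by_cases hi : i = w
      · rw [hi]; exact hown
      · rw [hother i hi]; exact (ihw i).trans (hworkmono i)
    · rw [hrun2] at hi ⊢
      by_cases hiw : i = w
      · subst hiw
        rw [Function.update_self] at hi ⊢
        exact hstate hi
      · rw [Function.update_of_ne hiw] at hi ⊢
        rw [hother i hiw]
        exact ⟨fun j hj => (ihs i hi).1 j (hSle.trans hj), (ihs i hi).2⟩

/-- The bound is uniform in `k`: a round after time `t` does not count, and one that counts has its
clock at most `t`, where the invariant applies. -/
theorem trialCount_completes_le {υ} (hυ : ∀ i, IsComputationPower (υ i)) {G}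
    (hG : ∀ (x : Euc d) (m : ℕ), (∀ j : Fin d, m ≤ j → x j = 0) → ∀ (c : Bool) (i : Fin d),
      m + (if c = true then 1 else 0) ≤ (i : ℕ) → G x c i = 0)
    (t : ℝ≥0) (k : ℕ) (b : ℕ → Bool) :
    (trialCount (A.Completes υ G t) k b : ℝ) ≤ ∑ i, work (υ i) t := by
  classical
  induction k with
  | zero => simpa [trialCount] using Finset.sum_nonneg fun i _ => work_nonneg (hυ i) t
  | succ k ih =>
    by_cases hC : A.Completes υ G t k b
    · rw [← sum_workerCount, Nat.cast_sum]
      exact Finset.sum_le_sum fun i _ =>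
        ((A.run_invariant hυ hG t b (k + 1) hC.2.2).2.1 i).trans (work_mono (hυ i) hC.2.2)
    · have h : trialCount (A.Completes υ G t) (k + 1) b = trialCount (A.Completes υ G t) k b := by
        refine (Finset.sum_range_succ _ _).trans ?_
        rw [if_neg hC]; rfl
      rwa [h]

theorem iterate_apply_eq_zero {υ} (hυ : ∀ i, IsComputationPower (υ i)) {G}
    (hG : ∀ (x : Euc d) (m : ℕ), (∀ j : Fin d, m ≤ j → x j = 0) → ∀ (c : Bool) (i : Fin d),
      m + (if c = true then 1 else 0) ≤ (i : ℕ) → G x c i = 0)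
    {t : ℝ≥0} {b : ℕ → Bool} {k : ℕ} (hk : A.clock υ G b k ≤ t) {j : Fin d}
    (hj : successCount (A.Completes υ G t) k b ≤ j) : A.iterate υ G b k j = 0 := by
  by_contra hne
  obtain ⟨s, hs⟩ := A.supp_subset k _ j hne
  exact hs ((A.run_invariant hυ hG t b k hk).1 s j hj)

end AsyncAlgorithm

end

/-! ### Numerical constants -/

noncomputable section

theorem one_le_batchSize {p σ ε : ℝ} (hσ : 0 < σ) (hε : 0 < ε) : 1 ≤ batchSize p σ ε := by
  have := gateProb_pos (p := p) hσ hε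
  exact Nat.one_le_ceil_iff.2 (by positivity)

/-- This is the supermartingale condition with `a = 1/2` and `r = 1 / N`. The ceiling gives `N * q ≤
1/4 + q ≤ 5/4`, so `q * (exp (1/2) - 1) ≤ 0.7 * q ≤ 1 / N`, and `1 + 1 / N ≤ exp (1 / N)`. -/
theorem gateProb_exp_le {p σ ε : ℝ} (hσ : 0 < σ) (hε : 0 < ε) :
    gateProb p σ ε * Real.exp (1 / 2) + (1 - gateProb p σ ε)
      ≤ Real.exp (1 / batchSize p σ ε) := by
  have hN : (1 : ℝ) ≤ batchSize p σ ε := by exact_mod_cast one_le_batchSize (p := p) hσ hε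
  have hq0 := gateProb_pos (p := p) hσ hε
  have hq1 := gateProb_le_one p σ ε
  have hlt : (batchSize p σ ε : ℝ) < 1 / (4 * gateProb p σ ε) + 1 :=
    Nat.ceil_lt_add_one (by positivity)
  set q := gateProb p σ ε
  set N : ℝ := (batchSize p σ ε : ℝ)
  have hNq : N * q ≤ 5 / 4 := by
    have h1 : N * q ≤ (1 / (4 * q) + 1) * q := by gcongr
    have h2 : (1 / (4 * q) + 1) * q = 1 / 4 + q := by field_simp
    linarith
  have he : Real.exp (1 / 2) ≤ 17 / 10 := by
    have h1 : Real.exp (1 / 2) ^ 2 = Real.exp 1 := by rw [← Real.exp_nat_mul]; norm_num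
    have h2 := Real.exp_one_lt_d9
    refine le_of_sq_le_sq ?_ (by norm_num)
    rw [h1]; norm_num at h2 ⊢; linarith
  have h3 : q * (7 / 10) ≤ 1 / N := by
    rw [le_div_iff₀ (by linarith)]; nlinarith
  have h4 := Real.add_one_le_exp (1 / N)
  nlinarith

/-- With `y = σ / ε`, the number `1 / q` is the maximum of `(y / κ) ^ a` and `1`, while `⌈y⌉` lies
between `max y 1` and `2 * max y 1`. -/
theorem batchSize_bounds {p : ℝ} (hp : 1 < p) : ∃ c₁ c₂ : ℝ, 0 < c₁ ∧ 0 < c₂ ∧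
    ∀ σ ε : ℝ, 0 < σ → 0 < ε →
      c₁ * (⌈σ / ε⌉ : ℝ) ^ (p / (p - 1)) ≤ (batchSize p σ ε : ℝ) ∧
      (batchSize p σ ε : ℝ) ≤ c₂ * (⌈σ / ε⌉ : ℝ) ^ (p / (p - 1)) := by
  set a := p / (p - 1) with ha
  have ha0 : 0 < a := div_pos (by linarith) (by linarith)
  set κ : ℝ := 92 * (2 : ℝ) ^ (1 / p) with hκ
  have hκ1 : 1 ≤ κ := by
    have : (1 : ℝ) ≤ (2 : ℝ) ^ (1 / p) := Real.one_le_rpow (by norm_num) (by positivity)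
    rw [hκ]; linarith
  have hκa : 1 ≤ κ ^ a := Real.one_le_rpow hκ1 ha0.le
  have h2a : (0 : ℝ) < 2 ^ a := by positivity
  refine ⟨1 / (4 * 2 ^ a * κ ^ a), 2, by positivity, by norm_num, fun σ ε hσ hε => ?_⟩
  have hq0 := gateProb_pos (p := p) hσ hε
  have hB1 : (1 : ℝ) ≤ batchSize p σ ε := by exact_mod_cast one_le_batchSize (p := p) hσ hε
  have hle : 1 / (4 * gateProb p σ ε) ≤ batchSize p σ ε := Nat.le_ceil _
  have hlt : (batchSize p σ ε : ℝ) < 1 / (4 * gateProb p σ ε) + 1 :=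
    Nat.ceil_lt_add_one (by positivity)
  set y := σ / ε with hy
  have hy0 : 0 < y := by positivity
  have hm1 : (1 : ℝ) ≤ ⌈y⌉ := by exact_mod_cast Int.one_le_ceil_iff.2 hy0
  have hym : y ≤ ⌈y⌉ := Int.le_ceil y
  have hmy : (⌈y⌉ : ℝ) < y + 1 := Int.ceil_lt_add_one y
  set m : ℝ := (⌈y⌉ : ℝ)
  set B : ℝ := (batchSize p σ ε : ℝ)
  have hpow : (92 * (2 : ℝ) ^ (1 / p) * ε / σ) ^ (p / (p - 1)) = κ ^ a / y ^ a := by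
    rw [← Real.div_rpow (by positivity) hy0.le, hy, hκ]
    congr 1
    field_simp
  have hgate : gateProb p σ ε = min (κ ^ a / y ^ a) 1 := by rw [gateProb, hpow]
  have hya : 0 < y ^ a := by positivity
  have hma : 1 ≤ m ^ a := Real.one_le_rpow hm1 ha0.le
  constructor
  · rw [div_mul_eq_mul_div, one_mul, div_le_iff₀ (by positivity)]
    rcases le_total y 1 with h | h
    · have h1 : m ^ a ≤ 2 ^ a := Real.rpow_le_rpow (by linarith) (by linarith) ha0.le
      have h2 : (1 : ℝ) ≤ 4 * κ ^ a * B := by nlinarith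
      nlinarith
    · have h1 : m ^ a ≤ 2 ^ a * y ^ a := by
        rw [← Real.mul_rpow (by norm_num) hy0.le]
        exact Real.rpow_le_rpow (by linarith) (by linarith) ha0.le
      have h2 : gateProb p σ ε ≤ κ ^ a / y ^ a := by rw [hgate]; exact min_le_left _ _
      have h3 : y ^ a ≤ 4 * κ ^ a * B := by
        rw [div_le_iff₀ (by positivity)] at hle
        rw [le_div_iff₀ hya] at h2
        have h4 : 1 * y ^ a ≤ B * (4 * gateProb p σ ε) * y ^ a := by gcongr
        nlinarith
      nlinarith
  · have h1 : 1 / (4 * gateProb p σ ε) ≤ m ^ a := by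
      rw [div_le_iff₀ (by positivity), hgate]
      rcases min_choice (κ ^ a / y ^ a) 1 with h | h
      · rw [h]
        have h2 : y ^ a ≤ m ^ a := Real.rpow_le_rpow hy0.le hym ha0.le
        have h3 : 1 / y ^ a ≤ κ ^ a / y ^ a := by gcongr
        have h4 : y ^ a * (1 / y ^ a) ≤ m ^ a * (κ ^ a / y ^ a) := by gcongr
        rw [mul_one_div_cancel hya.ne'] at h4
        linarith
      · rw [h]; linarith
    linarith

/-- The length of the chain. -/
def chainLength (L Δ ε : ℝ) : ℕ := ⌊L * Δ / (29184 * ε ^ 2)⌋₊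

theorem chain_ratio_ge {L Δ ε : ℝ} (hL : 0 < L) (hΔ : 0 < Δ) (hε : 0 < ε)
    (h : ε ≤ 1 / 2000 * √(L * Δ)) : 100 ≤ L * Δ / (29184 * ε ^ 2) := by
  rw [le_div_iff₀ (by positivity)]
  have h1 : ε ^ 2 ≤ (1 / 2000 * √(L * Δ)) ^ 2 := by gcongr
  rw [mul_pow, Real.sq_sqrt (by positivity)] at h1
  have : 0 < L * Δ := by positivity
  linarith

theorem chainLength_eq {L Δ ε : ℝ} (hL : 0 < L) (hΔ : 0 < Δ) :
    (⌊L * Δ / (29184 * ε ^ 2)⌋ : ℝ) = chainLength L Δ ε := by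
  rw [chainLength, natCast_floor_eq_intCast_floor (by positivity)]

/-- Writing `X` for the ratio inside the inner floor, the two floors and `log 2` leave at least `(X
- 1) / 2 - log 2 - 1`, which exceeds `X / 4` since `X ≥ 100`; and `116736 = 4 * 29184`. -/
theorem numEpochs_ge {L Δ ε : ℝ} (hL : 0 < L) (hΔ : 0 < Δ) (hε : 0 < ε)
    (h : ε ≤ 1 / 2000 * √(L * Δ)) :
    1 / 116736 * (L * Δ / ε ^ 2) ≤ (numEpochs L Δ ε : ℝ) := by
  have h1 := chain_ratio_ge hL hΔ hε h
  have h2 : L * Δ / ε ^ 2 = 29184 * (L * Δ / (29184 * ε ^ 2)) := by field_simp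
  have h3 := Int.lt_floor_add_one (L * Δ / (29184 * ε ^ 2))
  have h4 : Real.log (1 / 2) = -Real.log 2 := by rw [one_div, Real.log_inv]
  have h5 := Real.log_two_lt_d9
  have h6 := Int.lt_floor_add_one
    ((1 / 2 : ℝ) * (⌊L * Δ / (29184 * ε ^ 2)⌋ : ℝ) + Real.log (1 / 2))
  rw [h2, numEpochs]
  linarith

theorem toNat_numEpochs_le {L Δ ε : ℝ} (hL : 0 < L) (hΔ : 0 < Δ) (hε : 0 < ε)
    (h : ε ≤ 1 / 2000 * √(L * Δ)) :
    ((numEpochs L Δ ε).toNat : ℝ) ≤ 1 / 2 * chainLength L Δ ε + Real.log (1 / 2) := by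
  have h1 : (0 : ℝ) ≤ (numEpochs L Δ ε : ℝ) :=
    le_trans (by positivity) (numEpochs_ge hL hΔ hε h)
  have h2 : ((numEpochs L Δ ε).toNat : ℝ) = (numEpochs L Δ ε : ℝ) := by
    exact_mod_cast Int.toNat_of_nonneg (by exact_mod_cast h1)
  rw [h2, ← chainLength_eq hL hΔ]
  exact Int.floor_le _

/-! ### The lower bound on the time -/

/-- If the workers do at most `m` units of work up to time `t`, and `m / N + log 2 ≤ d / 2`, then
the expected gradient norm at the best iterate available at time `t` exceeds `ε`. -/
theorem lt_lintegral_iInf_norm_gradient {n d : ℕ} (hd : 0 < d) {f : Euc d → ℝ} {q ε r : ℝ}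
    (hε : 0 < ε) (hq0 : 0 ≤ q) (hq1 : q ≤ 1) (hr : 0 ≤ r)
    (hqr : q * Real.exp (1 / 2) + (1 - q) ≤ Real.exp r)
    (hlarge : ∀ x, x ⟨d - 1, Nat.sub_lt hd one_pos⟩ = 0 → 4 * ε ≤ ‖∇ f x‖)
    (hchain : ∀ x i j, j < i → (∀ l, j ≤ l → x l = 0) → ∇ f x i = 0)
    {υ : Fin n → ℝ → ℝ} (hυ : ∀ i, IsComputationPower (υ i)) (A : AsyncAlgorithm n d)
    {Ω : Type*} [MeasurableSpace Ω] {P : Measure Ω} [IsProbabilityMeasure P] {ξ : ℕ → Ω → Bool}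
    (hξ : ∀ k, Measurable (ξ k)) (hlaw : ∀ k, P.map (ξ k) = coinLaw q) (hind : iIndepFun ξ P)
    {t : ℝ≥0} {m : ℕ} (hwork : ∑ i, work (υ i) t ≤ m)
    (hm : r * m ≤ 1 / 2 * d + Real.log (1 / 2)) :
    ENNReal.ofReal ε < ∫⁻ ω, ⨅ k ∈ A.available υ (gatedGradient f q) (fun j => ξ j ω) t,
      ‖∇ f (A.iterate υ (gatedGradient f q) (fun j => ξ j ω) k)‖ₑ ∂P := by
  have hG : ∀ (x : Euc d) (m : ℕ), (∀ j : Fin d, m ≤ j → x j = 0) → ∀ (c : Bool) (i : Fin d),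
      m + (if c = true then 1 else 0) ≤ (i : ℕ) → gatedGradient f q x c i = 0 :=
    fun x m hx c i hi => gatedGradient_apply_eq_zero hchain hx c i hi
  have htrial : ∀ k b, trialCount (A.Completes υ (gatedGradient f q) t) k b ≤ m := fun k b => by
    exact_mod_cast (A.trialCount_completes_le hυ hG t k b).trans hwork
  obtain ⟨hmeas, hprob⟩ := measure_exists_le_successCount_le hξ hind hq0 hq1 hlaw
    (A.dependsOnPrefix_completes υ (gatedGradient f q) t) (by norm_num) hr hqr (T := d) htrial
  set S := {ω | ∃ k, d ≤ successCount (A.Completes υ (gatedGradient f q) t) k (fun j => ξ j ω)}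
  -- The term `log (1/2)` in `hm`, and hence in `K̃`, is there to make this probability at most
  -- `1/2`.
  have hhalf : P S ≤ ENNReal.ofReal (1 / 2) := by
    refine hprob.trans (ENNReal.ofReal_le_ofReal ?_)
    rw [← Real.exp_log (by norm_num : (0 : ℝ) < 1 / 2)]
    exact Real.exp_le_exp.2 (by simp only [Real.exp_log (by norm_num : (0 : ℝ) < 1 / 2)]; linarith)
  have hcompl : ENNReal.ofReal (1 / 2) ≤ P Sᶜ := by
    rw [prob_compl_eq_one_sub hmeas]
    refine le_trans (le_of_eq ?_) (tsub_le_tsub_left hhalf 1)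
    rw [← ENNReal.ofReal_one, ← ENNReal.ofReal_sub _ (by norm_num)]
    norm_num
  calc ENNReal.ofReal ε < ENNReal.ofReal (4 * ε * (1 / 2)) :=
        (ENNReal.ofReal_lt_ofReal_iff (by positivity)).2 (by linarith)
    _ = ENNReal.ofReal (4 * ε) * ENNReal.ofReal (1 / 2) := ENNReal.ofReal_mul (by positivity)
    _ ≤ ENNReal.ofReal (4 * ε) * P Sᶜ := by gcongr
    _ = ∫⁻ ω, Sᶜ.indicator (fun _ => ENNReal.ofReal (4 * ε)) ω ∂P :=
        (lintegral_indicator_const hmeas.compl _).symm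
    _ ≤ _ := by
        refine lintegral_mono fun ω => Set.indicator_apply_le' (fun hω => ?_) fun _ => zero_le
        refine le_iInf₂ fun k hk => ?_
        rw [← ofReal_norm]
        refine ENNReal.ofReal_le_ofReal (hlarge _ (A.iterate_apply_eq_zero hυ hG hk ?_))
        -- Fewer than `d` successes means at most `d - 1`, which is the index of the last
        -- coordinate, so that one is still zero.
        have h1 : ¬ d ≤ successCount (A.Completes υ (gatedGradient f q) t) k (fun j => ξ j ω) :=
          fun h => hω ⟨k, h⟩
        simp only
        omega

end

theorem mainTheorem5 :
    ∃ c : ℝ, 0 < c ∧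
    -- `K̃ = Ω(L Δ / ε²)`
    (∃ C : ℝ, 0 < C ∧ ∀ L Δ ε : ℝ, 0 < L → 0 < Δ → 0 < ε → ε ≤ c * √(L * Δ) →
      C * (L * Δ / ε ^ 2) ≤ (numEpochs L Δ ε : ℝ)) ∧
    -- `⌈1 / (4 q)⌉ = Θ(⌈σ / ε⌉ ^ (p / (p - 1)))`, with constants that depend on `p` only
    (∀ p : ℝ, 1 < p → p ≤ 2 → ∃ c₁ c₂ : ℝ, 0 < c₁ ∧ 0 < c₂ ∧
      ∀ σ ε : ℝ, 0 < σ → 0 < ε →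
        c₁ * (⌈σ / ε⌉ : ℝ) ^ (p / (p - 1)) ≤ (batchSize p σ ε : ℝ) ∧
        (batchSize p σ ε : ℝ) ≤ c₂ * (⌈σ / ε⌉ : ℝ) ^ (p / (p - 1))) ∧
    -- the lower bound on the time complexity
    (∀ (L Δ p σ ε : ℝ) (n : ℕ) (υ : Fin n → ℝ → ℝ),
      0 < L → 0 < Δ → 1 < p → p ≤ 2 → 0 < σ → 0 < ε → ε ≤ c * √(L * Δ) →
      (∀ i, IsComputationPower (υ i)) →
      ∃ (d : ℕ) (f : Euc d → ℝ) (Ξ : Type) (_ : MeasurableSpace Ξ) (D : Measure Ξ)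
        (G : Euc d → Ξ → Euc d),
        IsLSmooth L f ∧ BddBelow (Set.range f) ∧ f 0 - ⨅ x, f x ≤ Δ ∧
        IsProbabilityMeasure D ∧ IsPBCMOracle f D G p σ ∧
        ∀ (A : AsyncAlgorithm n d) (Ω : Type*) (_ : MeasurableSpace Ω) (P : Measure Ω)
          (ξ : ℕ → Ω → Ξ), IsProbabilityMeasure P →
          (∀ k, Measurable (ξ k)) → (∀ k, P.map (ξ k) = D) → iIndepFun ξ P →
          ∀ t : ℝ≥0,
            -- if the best iterate available at time `t` is `ε`-stationary in expectation,
            -- then `t > T_K̃`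
            (∫⁻ ω, ⨅ k ∈ A.available υ G (fun j => ξ j ω) t,
                ‖∇ f (A.iterate υ G (fun j => ξ j ω) k)‖ₑ ∂P ≤ ENNReal.ofReal ε →
              epochTime υ (batchSize p σ ε) (numEpochs L Δ ε).toNat < t) ∧
            -- in particular, so it is for any output chosen among the available iterates
            (∀ xhat : Ω → Euc d,
              (∀ ω, ∃ k ∈ A.available υ G (fun j => ξ j ω) t,
                xhat ω = A.iterate υ G (fun j => ξ j ω) k) →
              ∫⁻ ω, ‖∇ f (xhat ω)‖ₑ ∂P ≤ ENNReal.ofReal ε →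
              epochTime υ (batchSize p σ ε) (numEpochs L Δ ε).toNat < t)) := by
  refine ⟨1 / 2000, by norm_num, ⟨1 / 116736, by norm_num, fun L Δ ε hL hΔ hε h =>
    numEpochs_ge hL hΔ hε h⟩, fun p hp _ => batchSize_bounds hp, ?_⟩
  intro L Δ p σ ε n υ hL hΔ hp _ hσ hε hc hυ
  have hratio := chain_ratio_ge hL hΔ hε hc
  have hd : 0 < chainLength L Δ ε := Nat.floor_pos.2 (by linarith)
  obtain ⟨f, hsmooth, hbdd, hgap, hlarge, hbound, hchain⟩ := exists_smooth_chain hd hL hε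
  have hq0 := gateProb_pos (p := p) hσ hε
  have hq1 := gateProb_le_one p σ ε
  refine ⟨chainLength L Δ ε, f, Bool, inferInstance, coinLaw (gateProb p σ ε),
    gatedGradient f (gateProb p σ ε), hsmooth, hbdd, hgap.trans ?_,
    isProbabilityMeasure_coinLaw hq0.le hq1, isPBCMOracle_gatedGradient hp hσ hε hbound hchain, ?_⟩
  -- The gap is at most `7776 / 29184` of `Δ`.
  · have h1 : (chainLength L Δ ε : ℝ) ≤ L * Δ / (29184 * ε ^ 2) := Nat.floor_le (by positivity)
    rw [le_div_iff₀ (by positivity)] at h1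
    rw [div_le_iff₀ hL]
    nlinarith [mul_pos hL hΔ]
  · intro A Ω _ P ξ _ hξ hlaw hind t
    have hbest : ∫⁻ ω, ⨅ k ∈ A.available υ (gatedGradient f (gateProb p σ ε)) (fun j => ξ j ω) t,
        ‖∇ f (A.iterate υ (gatedGradient f (gateProb p σ ε)) (fun j => ξ j ω) k)‖ₑ ∂P
          ≤ ENNReal.ofReal ε →
        epochTime υ (batchSize p σ ε) (numEpochs L Δ ε).toNat < t := by
      intro hle
      by_contra hcon
      have hN : (1 : ℝ) ≤ batchSize p σ ε := by exact_mod_cast one_le_batchSize (p := p) hσ hε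
      have hwork := sum_work_le_of_le_epochTime hυ _ _ t (not_lt.1 hcon)
      rw [← Nat.cast_mul] at hwork
      -- Taken with `m = K̃ * N` and `r = 1 / N`, so that `r * m = K̃`, and the condition on `m` is
      -- the definition of `K̃`.
      refine absurd hle (not_le.2 (lt_lintegral_iInf_norm_gradient hd hε hq0.le hq1 (by positivity)
        (gateProb_exp_le hσ hε) hlarge hchain hυ A hξ hlaw hind hwork ?_))
      refine le_trans (le_of_eq ?_) (toNat_numEpochs_le hL hΔ hε hc)
      push_cast
      field_simp
    refine ⟨hbest, fun xhat hx hle => hbest (le_trans (lintegral_mono fun ω => ?_) hle)⟩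
    obtain ⟨k, hk, hxk⟩ := hx ω
    rw [hxk]
    exact iInf₂_le k hk
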